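/- Let $m\ge 1$. A polygonal curve $f:[0,m]\to\mathbb R^n$ is a map that is affine on each $[i,i+1]$, $0\le i<m$. For a norm $\chi$ on $\mathbb R^n$, the Fréchet distance of polygonal curves $f:[0,m_f]\to\mathbb R^n$ and $g:[0,m_g]\to\mathbb R^n$ is $$D(f,g)=\inf_{\alpha,\beta}\ \max_{0\le\theta\le 1}\chi\big(f(\alpha(\theta))-g(\beta(\theta))\big),$$ where $\alpha:[0,1]\to[0,m_f]$ and $\beta:[0,1]\to[0,m_g]$ range over the continuous strictly increasing bijections. Consider real random access machine programs that may, besides unit-cost instructions, call two geometric primitives on the input curves: (i) at cost $H$: given $\delta$ and a cell $[i,i+1]\times[j,j+1]$ with $0\le i<m_f$, $0\le j<m_g$, determine for each of the four edges of the cell the end points of the (possibly empty) interval of points $(\rho_f,\rho_g)$ on that edge with $\chi(f(\rho_f)-g(\rho_g))\le\delta$; (ii) at cost $P$: determine one critical value of $\delta$, that is, one of $\chi(f(0)-g(0))$ and $\chi(f(m_f)-g(m_g))$ (endpoint values); the $\chi$-distance of a vertex $f(i)$ to a segment $g([j,j+1])$, or of a vertex $g(j)$ to a segment $f([i,i+1])$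 (entry values); the least $\delta\ge0$ such that some point of $g([j,j+1])$ is at $\chi$-distance at most $\delta$ from both $f(i)$ and $f(k)$, $i<k$, or such that some point of $f([i,i+1])$ is at $\chi$-distance at most $\delta$ from both $g(j)$ and $g(k)$, $j<k$ (clamped values). **Theorem.** There are one such program and a constant $C$ such that for all $n$, all norms $\chi$ on $\mathbb R^n$, all $m_f,m_g\ge1$, all polygonal curves $f:[0,m_f]\to\mathbb R^n$, $g:[0,m_g]\to\mathbb R^n$ and all integer costs $H=H(\chi)\ge1$, $P=P(\chi)\ge1$, the program halts with output exactly $D(f,g)$, after time at most $$C\Big(\big(m_g m_f^2+m_f m_g^2\big)\big(P(\chi)+\log(m_g m_f)\big)+m_f m_g\,H(\chi)\Big).$$ -/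

import Mathlib

open Set

noncomputable section

namespace FrechetAlgo

/-! ## Curves in `ℝⁿ`, the Fréchet distance and the free space

A norm on `ℝⁿ` is a `χ : Seminorm ℝ (Fin n → ℝ)` with `χ x = 0 → x = 0`. A curve on `[a, b]` is
represented by a function on `ℝ` of which only the values on `[a, b]` are ever used. -/

/-- `f` restricted to `[0, m]` is a polygonal curve: it is affine on each `[i, i + 1]`, `i < m`. -/
def IsPolygonal {n : ℕ} (m : ℕ) (f : ℝ → Fin n → ℝ) : Prop :=
  ∀ i : ℕ, i < m → ∀ t ∈ Icc (0 : ℝ) 1,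
    f ((i : ℝ) + t) = (1 - t) • f (i : ℝ) + t • f ((i : ℝ) + 1)

/-- Continuous, strictly increasing bijections from `[0, 1]` onto `[a, b]`. -/
def IsReparam (a b : ℝ) (α : ℝ → ℝ) : Prop :=
  ContinuousOn α (Icc 0 1) ∧ StrictMonoOn α (Icc 0 1) ∧ BijOn α (Icc 0 1) (Icc a b)

/-- The Fréchet distance, for the norm `χ`, of the curves `f` on `[a, b]` and `g` on `[c, d]`. -/
def frechetDist {n : ℕ} (χ : Seminorm ℝ (Fin n → ℝ)) (f : ℝ → Fin n → ℝ) (a b : ℝ)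
    (g : ℝ → Fin n → ℝ) (c d : ℝ) : ℝ :=
  sInf {r : ℝ | ∃ α β : ℝ → ℝ, IsReparam a b α ∧ IsReparam c d β ∧
    IsGreatest ((fun θ => χ (f (α θ) - g (β θ))) '' Icc (0 : ℝ) 1) r}

/-- The data of a problem instance: a norm and two curves, on `[0, mf]` and on `[0, mg]`. -/
structure Instance (n : ℕ) where
  χ : Seminorm ℝ (Fin n → ℝ)
  mf : ℕ
  mg : ℕ
  f : ℝ → Fin n → ℝ
  g : ℝ → Fin n → ℝ

variable {n : ℕ}

/-- The `δ`-free space of the two curves. -/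
def Instance.freeSpace (I : Instance n) (δ : ℝ) : Set (ℝ × ℝ) :=
  {ρ | ρ.1 ∈ Icc (0 : ℝ) I.mf ∧ ρ.2 ∈ Icc (0 : ℝ) I.mg ∧ I.χ (I.f ρ.1 - I.g ρ.2) ≤ δ}

/-- The free space on edge `q` of the cell `[i, i + 1] × [j, j + 1]`, given by the coordinate that
varies along the edge. Edges `0, 1, 2, 3` are the bottom, right, top and left edge. -/
def Instance.freeEdge (I : Instance n) (δ : ℝ) (i j : ℕ) : ℕ → Set ℝ
  | 0 => {x | x ∈ Icc (i : ℝ) (i + 1) ∧ (x, (j : ℝ)) ∈ I.freeSpace δ}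
  | 1 => {y | y ∈ Icc (j : ℝ) (j + 1) ∧ ((i : ℝ) + 1, y) ∈ I.freeSpace δ}
  | 2 => {x | x ∈ Icc (i : ℝ) (i + 1) ∧ (x, (j : ℝ) + 1) ∈ I.freeSpace δ}
  | _ => {y | y ∈ Icc (j : ℝ) (j + 1) ∧ ((i : ℝ), y) ∈ I.freeSpace δ}

open Classical in
/-- The two ends `a, b` of the free interval on edge `q` of cell `i, j`; `none` if it is empty. -/
def Instance.cellParam (I : Instance n) (δ : ℝ) (i j q : ℕ) : Option (ℝ × ℝ) :=
  if (I.freeEdge δ i j q).Nonempty then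
    some (sInf (I.freeEdge δ i j q), sSup (I.freeEdge δ i j q))
  else none

/-! ## Critical values -/

/-- The points at `χ`-distance at most `δ` from `s`. -/
def ball (χ : Seminorm ℝ (Fin n → ℝ)) (s : Fin n → ℝ) (δ : ℝ) : Set (Fin n → ℝ) :=
  {q | χ (q - s) ≤ δ}

/-- The distance of the point `s` to the segment from `z` to `z'`. -/
def segDist (χ : Seminorm ℝ (Fin n → ℝ)) (s z z' : Fin n → ℝ) : ℝ :=
  sInf ((fun y => χ (y - s)) '' segment ℝ z z')

/-- The least `δ ≥ 0` for which the `δ`-balls around `s₁` and `s₂` meet in a point of the segment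
from `z` to `z'`. -/
def clampDist (χ : Seminorm ℝ (Fin n → ℝ)) (s₁ s₂ z z' : Fin n → ℝ) : ℝ :=
  sInf {δ : ℝ | 0 ≤ δ ∧ (ball χ s₁ δ ∩ ball χ s₂ δ ∩ segment ℝ z z').Nonempty}

/-- The kinds of critical values: the two endpoint values, the entry values through the left and
through the bottom edge of a cell, and the horizontally and vertically clamped values. -/
inductive Critical (α : Type) : Type
  | startPoint : Critical α
  | endPoint : Critical α
  | entryLeft (i j : α) : Critical α
  | entryBottom (i j : α) : Critical α
  | clampHor (i k j : α) : Critical α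
  | clampVert (i j k : α) : Critical α

/-- The critical values that exist for curves with `mf` and `mg` segments. -/
def Critical.Valid (mf mg : ℕ) : Critical ℕ → Prop
  | .startPoint => True
  | .endPoint => True
  | .entryLeft i j => i ≤ mf ∧ j < mg
  | .entryBottom i j => i < mf ∧ j ≤ mg
  | .clampHor i k j => i < k ∧ k ≤ mf ∧ j < mg
  | .clampVert i j k => i < mf ∧ j < k ∧ k ≤ mg

/-- The critical value of `δ` described by an index. -/
def Instance.critical (I : Instance n) : Critical ℕ → ℝ
  | .startPoint => I.χ (I.f 0 - I.g 0)
  | .endPoint => I.χ (I.f I.mf - I.g I.mg)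
  | .entryLeft i j => segDist I.χ (I.f i) (I.g j) (I.g ((j : ℝ) + 1))
  | .entryBottom i j => segDist I.χ (I.g j) (I.f i) (I.f ((i : ℝ) + 1))
  | .clampHor i k j => clampDist I.χ (I.f i) (I.f k) (I.g j) (I.g ((j : ℝ) + 1))
  | .clampVert i j k => clampDist I.χ (I.g j) (I.g k) (I.f i) (I.f ((i : ℝ) + 1))

/-! ## The machine model

Structured programs for a unit-cost real random access machine. The memory consists of arrays of
natural numbers and arrays of real numbers; the name of an array is fixed in the program text, the
index is computed at run time, and a scalar variable is an array cell with a constant index. Two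
further instructions call the geometric primitives, at costs `H` and `P`. -/

/-- The memory. -/
structure State where
  nats : ℕ → ℕ → ℕ
  reals : ℕ → ℕ → ℝ

/-- Expressions for natural numbers; subtraction is truncated. -/
inductive NExp : Type
  | const (k : ℕ) : NExp
  | load (arr : ℕ) (idx : NExp) : NExp
  | add (a b : NExp) : NExp
  | sub (a b : NExp) : NExp
  | mul (a b : NExp) : NExp

/-- Expressions for real numbers; the only constants are natural numbers, and `x / 0 = 0`. -/
inductive RExp : Type
  | ofNat (a : NExp) : RExp
  | load (arr : ℕ) (idx : NExp) : RExp
  | add (a b : RExp) : RExp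
  | sub (a b : RExp) : RExp
  | mul (a b : RExp) : RExp
  | div (a b : RExp) : RExp

/-- Tests. -/
inductive Test : Type
  | natLE (a b : NExp) : Test
  | realLE (a b : RExp) : Test
  | not (a : Test) : Test
  | and (a b : Test) : Test

/-- The value of an expression. -/
def NExp.eval (s : State) : NExp → ℕ
  | .const k => k
  | .load arr idx => s.nats arr (idx.eval s)
  | .add a b => a.eval s + b.eval s
  | .sub a b => a.eval s - b.eval s
  | .mul a b => a.eval s * b.eval s

/-- The value of an expression. -/
def RExp.eval (s : State) : RExp → ℝ
  | .ofNat a => (a.eval s : ℝ)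
  | .load arr idx => s.reals arr (idx.eval s)
  | .add a b => a.eval s + b.eval s
  | .sub a b => a.eval s - b.eval s
  | .mul a b => a.eval s * b.eval s
  | .div a b => a.eval s / b.eval s

/-- Whether a test succeeds. -/
def Test.Holds (s : State) : Test → Prop
  | .natLE a b => a.eval s ≤ b.eval s
  | .realLE a b => a.eval s ≤ b.eval s
  | .not a => ¬ a.Holds s
  | .and a b => a.Holds s ∧ b.Holds s

/-- The number of steps needed to evaluate an expression. -/
def NExp.cost : NExp → ℕ
  | .const _ => 1
  | .load _ idx => idx.cost + 1
  | .add a b => a.cost + b.cost + 1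
  | .sub a b => a.cost + b.cost + 1
  | .mul a b => a.cost + b.cost + 1

/-- The number of steps needed to evaluate an expression. -/
def RExp.cost : RExp → ℕ
  | .ofNat a => a.cost + 1
  | .load _ idx => idx.cost + 1
  | .add a b => a.cost + b.cost + 1
  | .sub a b => a.cost + b.cost + 1
  | .mul a b => a.cost + b.cost + 1
  | .div a b => a.cost + b.cost + 1

/-- The number of steps needed to evaluate a test. -/
def Test.cost : Test → ℕ
  | .natLE a b => a.cost + b.cost + 1
  | .realLE a b => a.cost + b.cost + 1
  | .not a => a.cost + 1
  | .and a b => a.cost + b.cost + 1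

/-- The index of a critical value, with its arguments evaluated. -/
def Critical.eval (s : State) : Critical NExp → Critical ℕ
  | .startPoint => .startPoint
  | .endPoint => .endPoint
  | .entryLeft i j => .entryLeft (i.eval s) (j.eval s)
  | .entryBottom i j => .entryBottom (i.eval s) (j.eval s)
  | .clampHor i k j => .clampHor (i.eval s) (k.eval s) (j.eval s)
  | .clampVert i j k => .clampVert (i.eval s) (j.eval s) (k.eval s)

/-- The number of steps needed to evaluate the arguments of a critical value. -/
def Critical.cost : Critical NExp → ℕ
  | .startPoint => 0
  | .endPoint => 0
  | .entryLeft i j => i.cost + j.cost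
  | .entryBottom i j => i.cost + j.cost
  | .clampHor i k j => i.cost + k.cost + j.cost
  | .clampVert i j k => i.cost + j.cost + k.cost

/-- Programs. `critical arr idx q` stores the critical value `q` in a cell of a real array;
`cell narr rarr i j δ` stores the boundary parameters of cell `i, j` for the value `δ`: for each
edge `q`, a flag (`1` if the free interval is not empty) in `narr[q]`, and its two ends in
`rarr[2q]` and `rarr[2q + 1]`. -/
inductive Prog : Type
  | skip : Prog
  | setNat (arr : ℕ) (idx : NExp) (e : NExp) : Prog
  | setReal (arr : ℕ) (idx : NExp) (e : RExp) : Prog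
  | critical (arr : ℕ) (idx : NExp) (q : Critical NExp) : Prog
  | cell (narr rarr : ℕ) (i j : NExp) (δ : RExp) : Prog
  | seq (c d : Prog) : Prog
  | ite (t : Test) (c d : Prog) : Prog
  | loop (t : Test) (c : Prog) : Prog

/-- Write into a cell of an array of natural numbers. -/
def State.setNat (s : State) (arr idx v : ℕ) : State :=
  { s with nats := Function.update s.nats arr (Function.update (s.nats arr) idx v) }

/-- Write into a cell of an array of real numbers. -/
def State.setReal (s : State) (arr idx : ℕ) (v : ℝ) : State :=
  { s with reals := Function.update s.reals arr (Function.update (s.reals arr) idx v) }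

/-- Store the parameters of the four edges of a cell; the ends of an empty interval are
stored as `0`. -/
def State.setCell (s : State) (narr rarr : ℕ) (p : ℕ → Option (ℝ × ℝ)) : State where
  nats := Function.update s.nats narr fun k =>
    if k < 4 then (if (p k).isSome then 1 else 0) else s.nats narr k
  reals := Function.update s.reals rarr fun k =>
    if k < 8 then
      (let ab := (p (k / 2)).getD (0, 0)
       if k % 2 = 0 then ab.1 else ab.2)
    else s.reals rarr k

/-- `Exec I H P c s s' t`: on the instance `I`, with costs `H` and `P` of the two primitives, the
program `c` started in state `s` halts in state `s'` after time `t`. A program that calls a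
primitive with an index out of range has no further execution. -/
inductive Exec (I : Instance n) (H P : ℕ) : Prog → State → State → ℕ → Prop
  | skip (s : State) : Exec I H P .skip s s 1
  | setNat (s : State) (arr : ℕ) (idx e : NExp) :
      Exec I H P (.setNat arr idx e) s (s.setNat arr (idx.eval s) (e.eval s))
        (idx.cost + e.cost + 1)
  | setReal (s : State) (arr : ℕ) (idx : NExp) (e : RExp) :
      Exec I H P (.setReal arr idx e) s (s.setReal arr (idx.eval s) (e.eval s))
        (idx.cost + e.cost + 1)
  | critical (s : State) (arr : ℕ) (idx : NExp) (q : Critical NExp)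
      (hq : (q.eval s).Valid I.mf I.mg) :
      Exec I H P (.critical arr idx q) s (s.setReal arr (idx.eval s) (I.critical (q.eval s)))
        (idx.cost + q.cost + P)
  | cell (s : State) (narr rarr : ℕ) (i j : NExp) (δ : RExp)
      (hi : i.eval s < I.mf) (hj : j.eval s < I.mg) :
      Exec I H P (.cell narr rarr i j δ) s
        (s.setCell narr rarr (I.cellParam (δ.eval s) (i.eval s) (j.eval s)))
        (i.cost + j.cost + δ.cost + H)
  | seq (c d : Prog) (s₁ s₂ s₃ : State) (t u : ℕ) (hc : Exec I H P c s₁ s₂ t)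
      (hd : Exec I H P d s₂ s₃ u) : Exec I H P (.seq c d) s₁ s₃ (t + u)
  | iteTrue (b : Test) (c d : Prog) (s s' : State) (t : ℕ) (hb : b.Holds s)
      (hc : Exec I H P c s s' t) : Exec I H P (.ite b c d) s s' (b.cost + t)
  | iteFalse (b : Test) (c d : Prog) (s s' : State) (t : ℕ) (hb : ¬ b.Holds s)
      (hd : Exec I H P d s s' t) : Exec I H P (.ite b c d) s s' (b.cost + t)
  | loopStop (b : Test) (c : Prog) (s : State) (hb : ¬ b.Holds s) :
      Exec I H P (.loop b c) s s b.cost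
  | loopStep (b : Test) (c : Prog) (s₁ s₂ s₃ : State) (t u : ℕ) (hb : b.Holds s₁)
      (hc : Exec I H P c s₁ s₂ t) (hl : Exec I H P (.loop b c) s₂ s₃ u) :
      Exec I H P (.loop b c) s₁ s₃ (b.cost + t + u)

/-- The row by row list of the coordinates of the vertices `f 0, …, f m`, followed by zeros. -/
def coords (m : ℕ) (f : ℝ → Fin n → ℝ) (k : ℕ) : ℝ :=
  if h : k % n < n then (if k / n ≤ m then f ((k / n : ℕ) : ℝ) ⟨k % n, h⟩ else 0) else 0

/-- The initial memory. Array `0` of natural numbers holds `mf, mg, n`; arrays `1` and `2` of real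
numbers hold the coordinates of the vertices of the two curves; all other cells are `0`. -/
def Instance.initial (I : Instance n) : State where
  nats := fun arr k =>
    if arr = 0 then (if k = 0 then I.mf else if k = 1 then I.mg else if k = 2 then n else 0) else 0
  reals := fun arr k =>
    if arr = 1 then coords I.mf I.f k else if arr = 2 then coords I.mg I.g k else 0

end FrechetAlgo

end

namespace FrechetAlgo

variable {n : ℕ}

/-! ## Geometry of polygonal curves -/

/-! A pair of reparametrizations is a monotone path from corner to corner in the free space, and a
monotone path splits into maximal runs along rows and columns of cells. In each cell the free space
is convex, since `χ` is a seminorm and both curves are affine there. So a run that enters a row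
through the bottom of a cell may use every free point of that cell's right edge, wherever it
entered. Whether a run can be continued therefore depends only on its own cells, and reachability of
the last cell becomes a finite recursion on cells (`Instance.Reach`). `Instance.Reach.joined` turns
this recursion into a path, `Instance.reachEnd_of_crossings` a path into the recursion.

A run crosses the free intervals of consecutive parallel edges. The crossing is possible exactly
when every interval is nonempty and none lies strictly above a later one, a condition on pairs of
edges (`Instance.Joined.run`). By `Instance.rowOK_iff` each pair contributes one threshold: the
entry value of the edge, or, for two different edges, `0` if their nearest points are already in
order and the clamped value otherwise. A run costs the maximum over its pairs, which an interval
recursion computes with one critical value per table entry (`Instance.RunCost.step`).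

The least `δ` at which a cell is reached is then a minimum over the start of the last run of the
maximum of two earlier costs. With the two endpoint values this gives the Fréchet distance exactly
(`Instance.isLeast_dist`). There are cubically many run costs and transitions, and one call of the
cell primitive per edge. Critical values are never sorted, so the logarithmic term of the bound is
slack. -/

lemma seminorm_continuous (χ : Seminorm ℝ (Fin n → ℝ)) : Continuous χ :=
  continuousOn_univ.1 (χ.convexOn.continuousOn isOpen_univ)

/-- The parameters in `[j, j + 1]` of the points of `g` at distance at most `δ` from `s`. -/
def slab (χ : Seminorm ℝ (Fin n → ℝ)) (s : Fin n → ℝ) (g : ℝ → Fin n → ℝ) (j : ℕ) (δ : ℝ) :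
    Set ℝ :=
  {y | y ∈ Icc (j : ℝ) (j + 1) ∧ χ (g y - s) ≤ δ}

lemma slab_mono {χ : Seminorm ℝ (Fin n → ℝ)} {s : Fin n → ℝ} {g : ℝ → Fin n → ℝ} {j : ℕ}
    {δ δ' : ℝ} (h : δ ≤ δ') : slab χ s g j δ ⊆ slab χ s g j δ' :=
  fun _ hy => ⟨hy.1, hy.2.trans h⟩

lemma IsPolygonal.eq_on_piece {m : ℕ} {f : ℝ → Fin n → ℝ} (hf : IsPolygonal m f) {i : ℕ}
    (hi : i < m) {x : ℝ} (hx : x ∈ Icc (i : ℝ) (i + 1)) :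
    f x = (1 - (x - i)) • f (i : ℝ) + (x - i) • f ((i : ℝ) + 1) := by
  have := hf i hi (x - i) ⟨by linarith [hx.1], by linarith [hx.2]⟩
  rwa [add_sub_cancel] at this

lemma IsPolygonal.convex_comb {m : ℕ} {f : ℝ → Fin n → ℝ} (hf : IsPolygonal m f) {i : ℕ}
    (hi : i < m) {x x' θ : ℝ} (hx : x ∈ Icc (i : ℝ) (i + 1)) (hx' : x' ∈ Icc (i : ℝ) (i + 1))
    (hθ : θ ∈ Icc (0 : ℝ) 1) :
    f (x + θ * (x' - x)) = (1 - θ) • f x + θ • f x' := by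
  have hm : x + θ * (x' - x) ∈ Icc (i : ℝ) (i + 1) := by
    obtain ⟨h0, h1⟩ := hθ
    constructor
    · nlinarith [hx.1, hx'.1]
    · nlinarith [hx.2, hx'.2]
  rw [hf.eq_on_piece hi hm, hf.eq_on_piece hi hx, hf.eq_on_piece hi hx']
  ext k
  simp only [Pi.add_apply, Pi.smul_apply, smul_eq_mul]
  ring

lemma IsPolygonal.continuousOn_piece {m : ℕ} {f : ℝ → Fin n → ℝ} (hf : IsPolygonal m f) {i : ℕ}
    (hi : i < m) : ContinuousOn f (Icc (i : ℝ) (i + 1)) := by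
  have : ContinuousOn (fun x : ℝ => (1 - (x - i)) • f (i : ℝ) + (x - i) • f ((i : ℝ) + 1))
      (Icc (i : ℝ) (i + 1)) := by fun_prop
  exact this.congr fun x hx => hf.eq_on_piece hi hx

lemma IsPolygonal.continuousOn {m : ℕ} {f : ℝ → Fin n → ℝ} (hf : IsPolygonal m f) :
    ContinuousOn f (Icc (0 : ℝ) m) := by
  suffices h : ∀ k ≤ m, ContinuousOn f (Icc (0 : ℝ) k) from h m le_rfl
  intro k
  induction k with
  | zero => intro _; simp
  | succ k ih =>
    intro hk
    have h1 := (ih (by omega)).union_of_isClosed (hf.continuousOn_piece (i := k) (by omega))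
      isClosed_Icc isClosed_Icc
    rw [Icc_union_Icc_eq_Icc (by positivity) (by linarith)] at h1
    simpa using h1

lemma free_convex_comb {χ : Seminorm ℝ (Fin n → ℝ)} {u u' : Fin n → ℝ} {δ θ : ℝ}
    (hθ : θ ∈ Icc (0 : ℝ) 1) (h : χ u ≤ δ) (h' : χ u' ≤ δ) :
    χ ((1 - θ) • u + θ • u') ≤ δ := by
  have h2 := map_add_le_add χ ((1 - θ) • u) (θ • u')
  rw [map_smul_eq_mul, map_smul_eq_mul, Real.norm_of_nonneg hθ.1,
    Real.norm_of_nonneg (sub_nonneg.2 hθ.2)] at h2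
  nlinarith [hθ.1, hθ.2]

section Slab

variable {χ : Seminorm ℝ (Fin n → ℝ)} {m : ℕ} {g : ℝ → Fin n → ℝ} {j : ℕ}

lemma slab_dist_continuousOn (hg : IsPolygonal m g) (hj : j < m) (s : Fin n → ℝ) :
    ContinuousOn (fun y => χ (g y - s)) (Icc (j : ℝ) (j + 1)) :=
  (seminorm_continuous χ).comp_continuousOn ((hg.continuousOn_piece hj).sub continuousOn_const)

lemma slab_isCompact (hg : IsPolygonal m g) (hj : j < m) (s : Fin n → ℝ) (δ : ℝ) :
    IsCompact (slab χ s g j δ) := by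
  have : slab χ s g j δ = Icc (j : ℝ) (j + 1) ∩ (fun y => χ (g y - s)) ⁻¹' Iic δ := rfl
  rw [this]
  exact isCompact_Icc.of_isClosed_subset
    ((slab_dist_continuousOn hg hj s).preimage_isClosed_of_isClosed isClosed_Icc isClosed_Iic)
    inter_subset_left

/-- Convexity of `χ` along an affine piece of `g` makes the free part of an edge an interval. -/
lemma slab_ordConnected (hg : IsPolygonal m g) (hj : j < m) {s : Fin n → ℝ} {δ y y' z : ℝ}
    (hy : y ∈ slab χ s g j δ) (hy' : y' ∈ slab χ s g j δ) (h : y ≤ z) (h' : z ≤ y') :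
    z ∈ slab χ s g j δ := by
  refine ⟨⟨hy.1.1.trans h, h'.trans hy'.1.2⟩, ?_⟩
  rcases h.eq_or_lt with rfl | hlt
  · exact hy.2
  have hpos : 0 < y' - y := by linarith
  have hθ : (z - y) / (y' - y) ∈ Icc (0 : ℝ) 1 :=
    ⟨div_nonneg (by linarith) hpos.le, (div_le_one hpos).2 (by linarith)⟩
  have hz : z = y + (z - y) / (y' - y) * (y' - y) := by field_simp; ring
  have := free_convex_comb hθ hy.2 hy'.2
  rw [hz, hg.convex_comb hj hy.1 hy'.1 hθ]
  convert this using 2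
  module

lemma segment_eq_image_piece (hg : IsPolygonal m g) (hj : j < m) :
    segment ℝ (g (j : ℝ)) (g ((j : ℝ) + 1)) = g '' Icc (j : ℝ) (j + 1) := by
  rw [segment_eq_image]
  ext q
  constructor
  · rintro ⟨θ, hθ, rfl⟩
    exact ⟨j + θ, ⟨by linarith [hθ.1], by linarith [hθ.2]⟩, hg j hj θ hθ⟩
  · rintro ⟨y, hy, rfl⟩
    exact ⟨y - j, ⟨by linarith [hy.1], by linarith [hy.2]⟩, (hg.eq_on_piece hj hy).symm⟩

/-- The distance to a compact piece is attained, so the free interval is already nonempty at the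
entry value itself. -/
lemma slab_segDist_nonempty (hg : IsPolygonal m g) (hj : j < m) (s : Fin n → ℝ) :
    (slab χ s g j (segDist χ s (g (j : ℝ)) (g ((j : ℝ) + 1)))).Nonempty := by
  obtain ⟨y, hy, hmin⟩ := isCompact_Icc.exists_isMinOn
    (nonempty_Icc.2 (by linarith : (j : ℝ) ≤ j + 1)) (slab_dist_continuousOn (χ := χ) hg hj s)
  refine ⟨y, hy, ?_⟩
  rw [segDist, segment_eq_image_piece hg hj, image_image]
  refine le_csInf ⟨_, y, hy, rfl⟩ ?_
  rintro _ ⟨z, hz, rfl⟩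
  exact hmin hz

lemma segDist_le_of_mem_slab (hg : IsPolygonal m g) (hj : j < m) {s : Fin n → ℝ} {δ y : ℝ}
    (hy : y ∈ slab χ s g j δ) : segDist χ s (g (j : ℝ)) (g ((j : ℝ) + 1)) ≤ δ := by
  rw [segDist, segment_eq_image_piece hg hj, image_image]
  refine le_trans (csInf_le ⟨0, ?_⟩ ⟨y, hy.1, rfl⟩) hy.2
  rintro _ ⟨z, _, rfl⟩
  exact apply_nonneg χ _

/-- The larger of the two distances is continuous and attains its minimum on the compact piece. This
minimum is the clamped value, and its minimizer lies in both intervals for every larger `δ`. -/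
lemma clampDist_le_iff (hg : IsPolygonal m g) (hj : j < m) (s t : Fin n → ℝ) {δ : ℝ} :
    clampDist χ s t (g (j : ℝ)) (g ((j : ℝ) + 1)) ≤ δ ↔
      (slab χ s g j δ ∩ slab χ t g j δ).Nonempty := by
  have hc : ContinuousOn (fun y => max (χ (g y - s)) (χ (g y - t))) (Icc (j : ℝ) (j + 1)) :=
    ContinuousOn.sup (slab_dist_continuousOn hg hj s) (slab_dist_continuousOn hg hj t)
  obtain ⟨y, hy, hmin⟩ := isCompact_Icc.exists_isMinOn
    (nonempty_Icc.2 (by linarith : (j : ℝ) ≤ j + 1)) hc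
  have key : IsLeast {δ : ℝ | 0 ≤ δ ∧
      (ball χ s δ ∩ ball χ t δ ∩ segment ℝ (g (j : ℝ)) (g ((j : ℝ) + 1))).Nonempty}
      (max (χ (g y - s)) (χ (g y - t))) := by
    rw [segment_eq_image_piece hg hj]
    refine ⟨⟨le_max_of_le_left (apply_nonneg χ _), g y, ⟨show χ (g y - s) ≤ _ from le_max_left _ _,
      show χ (g y - t) ≤ _ from le_max_right _ _⟩,
      y, hy, rfl⟩, ?_⟩
    rintro r ⟨_, _, ⟨h1, h2⟩, z, hz, rfl⟩
    exact (hmin hz).trans (max_le h1 h2)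
  rw [clampDist, key.csInf_eq]
  constructor
  · intro h
    exact ⟨y, ⟨hy, (le_max_left _ _).trans h⟩, hy, (le_max_right _ _).trans h⟩
  · rintro ⟨z, hz, hz'⟩
    exact (hmin hz.1).trans (max_le hz.2 hz'.2)

end Slab

/-! ## Reachability along rows and columns of cells -/

/-- The instance with the two curves exchanged. -/
def Instance.swap (I : Instance n) : Instance n := ⟨I.χ, I.mg, I.mf, I.g, I.f⟩

/-- The instance with the two curves exchanged if `o` is true. -/
def Instance.orient (I : Instance n) (o : Bool) : Instance n := if o then I.swap else I

/-- Both curves are polygonal and have at least one segment. -/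
structure Instance.Polygonal (I : Instance n) : Prop where
  f : IsPolygonal I.mf I.f
  g : IsPolygonal I.mg I.g
  mf_pos : 0 < I.mf
  mg_pos : 0 < I.mg

lemma Instance.Polygonal.swap {I : Instance n} (h : I.Polygonal) : I.swap.Polygonal :=
  ⟨h.g, h.f, h.mg_pos, h.mf_pos⟩

lemma Instance.Polygonal.orient {I : Instance n} (h : I.Polygonal) (o : Bool) :
    (I.orient o).Polygonal := by
  cases o
  · exact h
  · exact h.swap

/-- The free interval on the left edge of cell `p, j`. -/
def Instance.edge (I : Instance n) (δ : ℝ) (p j : ℕ) : Set ℝ := slab I.χ (I.f p) I.g j δ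

/-- The free intervals on the vertical edges `i + 1, …, k` of row `j` admit a monotone crossing:
no interval lies strictly above a later one. -/
def Instance.RowOK (I : Instance n) (δ : ℝ) (i k j : ℕ) : Prop :=
  ∀ p q, i < p → p ≤ q → q ≤ k → ∃ u ∈ I.edge δ p j, ∃ v ∈ I.edge δ q j, u ≤ v

/-- The cost of passing through the edges `p` and `q` in this order, where `x p` is a point on
edge `p` that is as close as possible. -/
noncomputable def Instance.pairCost (I : Instance n) (x : ℕ → ℕ → ℝ) (p q j : ℕ) : ℝ :=
  if p = q then I.critical (.entryLeft q j)
  else if x p j ≤ x q j then 0 else I.critical (.clampHor p q j)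

/-- `x p j` is a point at least distance on the left edge of cell `p, j`. -/
def Instance.Nearest (I : Instance n) (x : ℕ → ℕ → ℝ) : Prop :=
  ∀ p j, p < I.mf → j < I.mg → x p j ∈ I.edge (I.critical (.entryLeft p j)) p j

/-- The pairs `p = q` say that all intervals are nonempty, and each then contains its nearest point.
If these points are in order they witness the crossing of `p` and `q`; if not, a crossing in order
forces the two intervals to meet, which is what the clamped value measures. -/
lemma Instance.rowOK_iff {I : Instance n} (h : I.Polygonal) {x : ℕ → ℕ → ℝ} (hx : I.Nearest x)
    {δ : ℝ} (hδ : 0 ≤ δ) {i k j : ℕ} (hk : k < I.mf) (hj : j < I.mg) :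
    I.RowOK δ i k j ↔ ∀ p q, i < p → p ≤ q → q ≤ k → I.pairCost x p q j ≤ δ := by
  have hent : ∀ p, p ≤ k → (I.edge δ p j).Nonempty → x p j ∈ I.edge δ p j := by
    rintro p hp ⟨u, hu⟩
    exact slab_mono (segDist_le_of_mem_slab h.g hj hu) (hx p j (by omega) hj)
  have hord : ∀ {p y y' z}, y ∈ I.edge δ p j → y' ∈ I.edge δ p j → y ≤ z → z ≤ y' →
      z ∈ I.edge δ p j := fun hy hy' => slab_ordConnected h.g hj hy hy'
  constructor
  · intro hrow p q hip hpq hqk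
    obtain ⟨u, hu, v, hv, huv⟩ := hrow p q hip hpq hqk
    unfold pairCost
    split_ifs with h1 h2
    · exact segDist_le_of_mem_slab h.g hj hv
    · exact hδ
    · have hxp := hent p (by omega) ⟨u, hu⟩
      have hxq := hent q (by omega) ⟨v, hv⟩
      rw [not_le] at h2
      refine (clampDist_le_iff h.g hj _ _).2 ?_
      -- Here `x q j < x p j`, while `u ≤ v` with `u` on edge `p` and `v` on edge `q`. A common
      -- point is `x q j` if `u` is below it, and `u` otherwise.
      rcases le_total u (x q j) with h3 | h3
      · exact ⟨_, hord hu hxp h3 h2.le, hxq⟩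
      · exact ⟨u, hu, hord hxq hv h3 huv⟩
  · intro hc p q hip hpq hqk
    have hen : ∀ p, i < p → p ≤ k → x p j ∈ I.edge δ p j := by
      intro p hp hpk
      have := hc p p hp le_rfl hpk
      rw [pairCost, if_pos rfl] at this
      exact slab_mono this (hx p j (by omega) hj)
    have hpq' := hc p q hip hpq hqk
    unfold pairCost at hpq'
    split_ifs at hpq' with h1 h2
    · subst h1
      exact ⟨_, hen p hip hqk, _, hen p hip hqk, le_rfl⟩
    · exact ⟨_, hen p hip (by omega), _, hen q (by omega) hqk, h2⟩
    · obtain ⟨y, hy, hy'⟩ := (clampDist_le_iff h.g hj _ _).1 hpq'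
      exact ⟨y, hy, y, hy', le_rfl⟩

/-- `I.Reach δ o r c`: within the `δ`-free space some monotone path, all of whose maximal runs along
rows and columns admit crossings, reaches cell `r, c` at the end of a run along row `c`
(`o = false`), or cell `c, r` at the end of a run along column `c` (`o = true`). -/
inductive Instance.Reach (I : Instance n) (δ : ℝ) : Bool → ℕ → ℕ → Prop
  | start (o : Bool) : I.Reach δ o 0 0
  | step (o : Bool) (i r c : ℕ) (h : I.Reach δ (!o) c i) (hi : i < r)
      (hr : (I.orient o).RowOK δ i r c) : I.Reach δ o r c

lemma Instance.RowOK.mono {I : Instance n} {δ δ' : ℝ} (hδ : δ ≤ δ') {i k j : ℕ}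
    (h : I.RowOK δ i k j) : I.RowOK δ' i k j := by
  intro p q h1 h2 h3
  obtain ⟨u, hu, v, hv, huv⟩ := h p q h1 h2 h3
  exact ⟨u, slab_mono hδ hu, v, slab_mono hδ hv, huv⟩

lemma Instance.Reach.mono {I : Instance n} {δ δ' : ℝ} (hδ : δ ≤ δ') {o : Bool} {r c : ℕ}
    (h : I.Reach δ o r c) : I.Reach δ' o r c := by
  induction h with
  | start o => exact .start o
  | step o i r c _ hi hr ih => exact .step o i r c ih hi (hr.mono hδ)

lemma Instance.reach_iff {I : Instance n} {δ : ℝ} {o : Bool} {r c : ℕ} :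
    I.Reach δ o r c ↔ (r = 0 ∧ c = 0) ∨
      ∃ i, i < r ∧ I.Reach δ (!o) c i ∧ (I.orient o).RowOK δ i r c := by
  constructor
  · intro h
    cases h with
    | start => exact .inl ⟨rfl, rfl⟩
    | step _ i _ _ h hi hr => exact .inr ⟨i, hi, h, hr⟩
  · rintro (⟨rfl, rfl⟩ | ⟨i, hi, h, hr⟩)
    · exact .start o
    · exact .step o i r c h hi hr

/-! ## Monotone paths in the free space -/

/-- The points `(a, b)` and `(a', b')` are joined by a monotone path in the `δ`-free space. -/
def Instance.Joined (I : Instance n) (δ a b a' b' : ℝ) : Prop :=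
  ∃ α β : ℝ → ℝ, Continuous α ∧ Monotone α ∧ Continuous β ∧ Monotone β ∧
    (∀ θ ≤ 0, α θ = a ∧ β θ = b) ∧ (∀ θ, 1 ≤ θ → α θ = a' ∧ β θ = b') ∧
    ∀ θ, I.χ (I.f (α θ) - I.g (β θ)) ≤ δ

lemma Instance.Joined.refl {I : Instance n} {δ a b : ℝ} (h : I.χ (I.f a - I.g b) ≤ δ) :
    I.Joined δ a b a b :=
  ⟨fun _ => a, fun _ => b, continuous_const, monotone_const, continuous_const, monotone_const,
    fun _ _ => ⟨rfl, rfl⟩, fun _ _ => ⟨rfl, rfl⟩, fun _ => h⟩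

/-- Both paths are constant outside `[0, 1]`. Hence the sum of the two rescaled paths minus the
junction point is the concatenation, with no case distinction needed for continuity. -/
lemma Instance.Joined.trans {I : Instance n} {δ a b a' b' a'' b'' : ℝ}
    (h : I.Joined δ a b a' b') (h' : I.Joined δ a' b' a'' b'') : I.Joined δ a b a'' b'' := by
  obtain ⟨α, β, cα, mα, cβ, mβ, h0, h1, hf⟩ := h
  obtain ⟨α', β', cα', mα', cβ', mβ', h0', h1', hf'⟩ := h'
  refine ⟨fun θ => α (2 * θ) + α' (2 * θ - 1) - a', fun θ => β (2 * θ) + β' (2 * θ - 1) - b',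
    by fun_prop, ?_, by fun_prop, ?_, ?_, ?_, ?_⟩
  · intro s t hst
    have := mα (show 2 * s ≤ 2 * t by linarith)
    have := mα' (show 2 * s - 1 ≤ 2 * t - 1 by linarith)
    dsimp only
    linarith
  · intro s t hst
    have := mβ (show 2 * s ≤ 2 * t by linarith)
    have := mβ' (show 2 * s - 1 ≤ 2 * t - 1 by linarith)
    dsimp only
    linarith
  · intro θ hθ
    have e := h0 (2 * θ) (by linarith)
    have e' := h0' (2 * θ - 1) (by linarith)
    simp [e.1, e.2, e'.1, e'.2]
  · intro θ hθ
    have e := h1 (2 * θ) (by linarith)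
    have e' := h1' (2 * θ - 1) (by linarith)
    simp [e.1, e.2, e'.1, e'.2]
  · intro θ
    rcases le_total (2 * θ) 1 with h | h
    · have e' := h0' (2 * θ - 1) (by linarith)
      simpa [e'.1, e'.2] using hf (2 * θ)
    · have e := h1 (2 * θ) h
      simpa [e.1, e.2] using hf' (2 * θ - 1)

lemma Instance.Joined.swap {I : Instance n} {δ a b a' b' : ℝ} (h : I.Joined δ a b a' b') :
    I.swap.Joined δ b a b' a' := by
  obtain ⟨α, β, cα, mα, cβ, mβ, h0, h1, hf⟩ := h
  refine ⟨β, α, cβ, mβ, cα, mα, fun θ hθ => (h0 θ hθ).symm, fun θ hθ => (h1 θ hθ).symm,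
    fun θ => ?_⟩
  have := hf θ
  rw [map_sub_rev] at this
  exact this

/-- By convexity of the free space inside a cell the straight segment stays free; it is monotone
because its ends are ordered. -/
lemma Instance.joined_of_cell {I : Instance n} (h : I.Polygonal) {δ a b a' b' : ℝ} {i j : ℕ}
    (hi : i < I.mf) (hj : j < I.mg) (ha : a ∈ Icc (i : ℝ) (i + 1)) (ha' : a' ∈ Icc (i : ℝ) (i + 1))
    (hb : b ∈ Icc (j : ℝ) (j + 1)) (hb' : b' ∈ Icc (j : ℝ) (j + 1)) (haa : a ≤ a') (hbb : b ≤ b')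
    (hf : I.χ (I.f a - I.g b) ≤ δ) (hf' : I.χ (I.f a' - I.g b') ≤ δ) :
    I.Joined δ a b a' b' := by
  set c : ℝ → ℝ := fun θ => max 0 (min 1 θ) with hc
  have c01 : ∀ θ, c θ ∈ Icc (0 : ℝ) 1 := fun θ =>
    ⟨le_max_left _ _, max_le zero_le_one (min_le_left _ _)⟩
  have cc : Continuous c := by fun_prop
  have cm : Monotone c := fun s t hst => max_le_max le_rfl (min_le_min le_rfl hst)
  have c0 : ∀ θ ≤ 0, c θ = 0 := fun θ hθ => max_eq_left ((min_le_right _ _).trans hθ)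
  have c1 : ∀ θ, 1 ≤ θ → c θ = 1 := fun θ hθ => by simp [hc, min_eq_left hθ]
  refine ⟨fun θ => a + c θ * (a' - a), fun θ => b + c θ * (b' - b), by fun_prop, ?_,
    by fun_prop, ?_, ?_, ?_, ?_⟩
  · intro s t hst
    have := mul_le_mul_of_nonneg_right (cm hst) (sub_nonneg.2 haa)
    dsimp only
    linarith
  · intro s t hst
    have := mul_le_mul_of_nonneg_right (cm hst) (sub_nonneg.2 hbb)
    dsimp only
    linarith
  · intro θ hθ
    simp [c0 θ hθ]
  · intro θ hθ
    simp [c1 θ hθ]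
  · intro θ
    have := free_convex_comb (c01 θ) hf hf'
    dsimp only
    rw [h.f.convex_comb hi ha ha' (c01 θ), h.g.convex_comb hj hb hb' (c01 θ)]
    convert this using 2
    module

lemma Instance.Joined.end_free {I : Instance n} {δ a b a' b' : ℝ} (h : I.Joined δ a b a' b') :
    I.χ (I.f a' - I.g b') ≤ δ := by
  obtain ⟨α, β, _, _, _, _, _, h1, hf⟩ := h
  have := hf 1
  rwa [(h1 1 le_rfl).1, (h1 1 le_rfl).2] at this

lemma Instance.mem_edge_iff {I : Instance n} {δ y : ℝ} {p j : ℕ} :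
    y ∈ I.edge δ p j ↔ y ∈ Icc (j : ℝ) (j + 1) ∧ I.χ (I.f p - I.g y) ≤ δ := by
  rw [map_sub_rev]
  rfl

/-- A run along row `j`, from the bottom edge of cell `i, j` to the left edge of cell `k, j`. -/
lemma Instance.Joined.run {I : Instance n} (h : I.Polygonal) {δ a b x : ℝ} {i k j : ℕ}
    (hj : j < I.mg) (hx : x ∈ Icc (i : ℝ) (i + 1)) (hw : I.Joined δ a b x j) (hik : i < k)
    (hk : k ≤ I.mf) (hr : I.RowOK δ i k j) :
    ∃ y ∈ Icc (j : ℝ) (j + 1), I.Joined δ a b k y := by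
  have least : ∀ p, i < p → p ≤ k → ∃ y, IsLeast (I.edge δ p j) y := by
    intro p hp hpk
    obtain ⟨u, hu, _⟩ := hr p p hp le_rfl hpk
    exact (slab_isCompact h.g hj _ δ).exists_isLeast ⟨u, hu⟩
  -- The run is greedy: every edge is crossed at the lowest height still available. That height is
  -- always the lowest free point of some edge `p` already crossed, which is what lets the pairwise
  -- condition be applied.
  suffices H : ∀ k', i + 1 ≤ k' → k' ≤ k → ∃ y ∈ I.edge δ k' j, I.Joined δ a b k' y ∧
      ∃ p, i < p ∧ p ≤ k' ∧ IsLeast (I.edge δ p j) y by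
    obtain ⟨y, hy, hJ, _⟩ := H k hik le_rfl
    exact ⟨y, hy.1, hJ⟩
  intro k' hk'
  induction k', hk' using Nat.le_induction with
  | base =>
    intro hk'
    obtain ⟨y, hy⟩ := least (i + 1) (by omega) hk'
    refine ⟨y, hy.1, hw.trans ?_, i + 1, by omega, le_rfl, hy⟩
    have hy1 := mem_edge_iff.1 hy.1
    refine joined_of_cell h (i := i) (j := j) (by omega) hj hx ?_ ?_ hy1.1 ?_ hy1.1.1
      hw.end_free hy1.2
    · push_cast; constructor <;> linarith
    · constructor <;> linarith
    · push_cast; exact hx.2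
  | succ k' hk' ih =>
    intro hkk
    obtain ⟨y, hy, hJ, p, hp, hpk, hl⟩ := ih (by omega)
    obtain ⟨z, hz⟩ := least (k' + 1) (by omega) hkk
    obtain ⟨u, hu, v, hv, huv⟩ := hr p (k' + 1) hp (by omega) hkk
    -- The condition for `p` and the new edge gives a free `v` there with `y ≤ u ≤ v`. So `max y z`
    -- lies between the free points `z` and `v` of that edge.
    have hmax : max y z ∈ I.edge δ (k' + 1) j :=
      slab_ordConnected h.g hj hz.1 hv (le_max_right _ _)
        (max_le ((hl.2 hu).trans huv) (hz.2 hv))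
    refine ⟨max y z, hmax, hJ.trans ?_, ?_⟩
    · have hm := mem_edge_iff.1 hmax
      refine joined_of_cell h (i := k') (j := j) (by omega) hj ?_ ?_ hy.1 hm.1 ?_
        (le_max_left _ _) hJ.end_free hm.2
      · constructor <;> linarith
      · push_cast; constructor <;> linarith
      · push_cast; linarith
    · rcases max_choice y z with e | e <;> rw [e]
      · exact ⟨p, hp, by omega, hl⟩
      · exact ⟨k' + 1, by omega, le_rfl, hz⟩

lemma Instance.swap_orient (I : Instance n) (o : Bool) : (I.orient (!o)).swap = I.orient o := by
  cases o <;> rfl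

/-- Induction along the runs. Each run ends on an edge of its last cell, and after exchanging the
curves that edge is where the next, perpendicular run starts. -/
lemma Instance.Reach.joined {I : Instance n} (h : I.Polygonal) {δ : ℝ} {o : Bool} {r c : ℕ}
    (hr : I.Reach δ o r c) (h0 : I.χ (I.f 0 - I.g 0) ≤ δ) :
    r < (I.orient o).mf → c < (I.orient o).mg →
      ∃ y ∈ Icc (c : ℝ) (c + 1), (I.orient o).Joined δ 0 0 r y := by
  induction hr with
  | start o =>
    intro _ _
    refine ⟨0, by simp, ?_⟩
    have : I.Joined δ 0 0 0 0 := .refl h0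
    cases o
    · rw [Nat.cast_zero]
      exact this
    · rw [Nat.cast_zero]
      exact this.swap
  | step o i r c _ hi hrow ih =>
    intro hr hc
    have e : (I.orient (!o)).mf = (I.orient o).mg ∧ (I.orient (!o)).mg = (I.orient o).mf := by
      cases o <;> exact ⟨rfl, rfl⟩
    obtain ⟨x, hx, hJ⟩ := ih (by omega) (by omega)
    have hJ' := hJ.swap
    rw [swap_orient] at hJ'
    exact hJ'.run (h.orient o) hc hx hi hr.le hrow

/-- Some monotone path whose maximal runs admit crossings reaches the last cell. -/
def Instance.ReachEnd (I : Instance n) (δ : ℝ) : Prop :=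
  I.Reach δ false (I.mf - 1) (I.mg - 1) ∨ I.Reach δ true (I.mg - 1) (I.mf - 1)

lemma Instance.Joined.to_corner {I : Instance n} (h : I.Polygonal) {δ y : ℝ}
    (hy : y ∈ Icc ((I.mg - 1 : ℕ) : ℝ) ((I.mg - 1 : ℕ) + 1))
    (hJ : I.Joined δ 0 0 (I.mf - 1 : ℕ) y) (h1 : I.χ (I.f I.mf - I.g I.mg) ≤ δ) :
    I.Joined δ 0 0 I.mf I.mg := by
  have ef : ((I.mf - 1 : ℕ) : ℝ) + 1 = I.mf := by
    have := Nat.sub_add_cancel h.mf_pos; exact_mod_cast this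
  have eg : ((I.mg - 1 : ℕ) : ℝ) + 1 = I.mg := by
    have := Nat.sub_add_cancel h.mg_pos; exact_mod_cast this
  refine hJ.trans (joined_of_cell h (i := I.mf - 1) (j := I.mg - 1)
    (Nat.sub_lt h.mf_pos one_pos) (Nat.sub_lt h.mg_pos one_pos) ?_ ?_ hy ?_ ?_ ?_ hJ.end_free h1)
  · constructor <;> linarith
  · rw [ef]; constructor <;> linarith
  · rw [eg]; constructor <;> linarith
  · linarith
  · rw [← eg]; exact hy.2

lemma Instance.ReachEnd.joined {I : Instance n} (h : I.Polygonal) {δ : ℝ} (hr : I.ReachEnd δ)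
    (h0 : I.χ (I.f 0 - I.g 0) ≤ δ) (h1 : I.χ (I.f I.mf - I.g I.mg) ≤ δ) :
    I.Joined δ 0 0 I.mf I.mg := by
  rcases hr with hr | hr
  · obtain ⟨y, hy, hJ⟩ := hr.joined h h0 (Nat.sub_lt h.mf_pos one_pos)
      (Nat.sub_lt h.mg_pos one_pos)
    exact Joined.to_corner h hy hJ h1
  · obtain ⟨y, hy, hJ⟩ := hr.joined h h0 (Nat.sub_lt h.mg_pos one_pos)
      (Nat.sub_lt h.mf_pos one_pos)
    rw [map_sub_rev] at h1
    exact (Joined.to_corner h.swap hy hJ h1).swap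

/-! ## The Fréchet distance through monotone paths -/

/-- Mixing a monotone path with a little of the constant-speed parametrization makes it strictly
increasing without moving its ends. -/
lemma isReparam_perturb {α : ℝ → ℝ} (hc : Continuous α) (hm : Monotone α) (h0 : α 0 = 0) {m η : ℝ}
    (h1 : α 1 = m) (hmp : 0 < m) (hη : 0 < η) (hη' : η ≤ 1) :
    IsReparam 0 m (fun θ => (1 - η) * α θ + η * (m * θ)) := by
  have cont : Continuous (fun θ => (1 - η) * α θ + η * (m * θ)) := by fun_prop
  have strict : StrictMono (fun θ => (1 - η) * α θ + η * (m * θ)) := by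
    intro s t hst
    have e1 := mul_le_mul_of_nonneg_left (hm hst.le) (sub_nonneg.2 hη')
    have e2 := mul_lt_mul_of_pos_left (mul_lt_mul_of_pos_left hst hmp) hη
    dsimp only
    linarith
  refine ⟨cont.continuousOn, strict.strictMonoOn _, ?_, strict.injective.injOn, ?_⟩
  · intro θ hθ
    have a0 := strict.monotone hθ.1
    have a1 := strict.monotone hθ.2
    simp only [h0, h1] at a0 a1
    constructor <;> dsimp only <;> linarith
  · have := intermediate_value_Icc (zero_le_one (α := ℝ)) cont.continuousOn
    simp only [h0, h1] at this
    rwa [show (1 - η) * 0 + η * (m * 0) = 0 by ring,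
      show (1 - η) * m + η * (m * 1) = m by ring] at this

lemma Instance.Polygonal.dist_continuousOn {I : Instance n} (h : I.Polygonal) :
    ContinuousOn (fun ρ : ℝ × ℝ => I.χ (I.f ρ.1 - I.g ρ.2))
      (Icc (0 : ℝ) I.mf ×ˢ Icc (0 : ℝ) I.mg) :=
  (seminorm_continuous I.χ).comp_continuousOn
    ((h.f.continuousOn.comp continuousOn_fst fun _ hρ => hρ.1).sub
      (h.g.continuousOn.comp continuousOn_snd fun _ hρ => hρ.2))

lemma Instance.Polygonal.exists_isGreatest {I : Instance n} (h : I.Polygonal) {α β : ℝ → ℝ}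
    (hα : IsReparam 0 I.mf α) (hβ : IsReparam 0 I.mg β) :
    ∃ r, IsGreatest ((fun θ => I.χ (I.f (α θ) - I.g (β θ))) '' Icc (0 : ℝ) 1) r := by
  have hc : ContinuousOn (fun θ => I.χ (I.f (α θ) - I.g (β θ))) (Icc (0 : ℝ) 1) :=
    h.dist_continuousOn.comp (f := fun θ => (α θ, β θ)) (hα.1.prodMk hβ.1)
      fun θ hθ => ⟨hα.2.2.1 hθ, hβ.2.2.1 hθ⟩
  exact (isCompact_Icc.image_of_continuousOn hc).exists_isGreatest
    ((nonempty_Icc.2 zero_le_one).image _)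

/-- The Fréchet distance of the two curves of an instance. -/
noncomputable def Instance.dist (I : Instance n) : ℝ := frechetDist I.χ I.f 0 I.mf I.g 0 I.mg

lemma Instance.dist_le_of_reparam {I : Instance n} (h : I.Polygonal) {α β : ℝ → ℝ}
    (hα : IsReparam 0 I.mf α) (hβ : IsReparam 0 I.mg β) {δ : ℝ}
    (hδ : ∀ θ ∈ Icc (0 : ℝ) 1, I.χ (I.f (α θ) - I.g (β θ)) ≤ δ) : I.dist ≤ δ := by
  obtain ⟨r, hr⟩ := h.exists_isGreatest hα hβ
  refine le_trans (csInf_le ⟨0, ?_⟩ ⟨α, β, hα, hβ, hr⟩) ?_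
  · rintro _ ⟨_, _, _, _, ⟨⟨θ, _, rfl⟩, _⟩⟩
    exact apply_nonneg I.χ _
  · obtain ⟨θ, hθ, rfl⟩ := hr.1
    exact hδ θ hθ

/-- The path may stand still in one coordinate. Perturbed by `isReparam_perturb` it is admissible,
and uniform continuity of the distance bounds the loss by any `ε > 0`. -/
lemma Instance.Joined.dist_le {I : Instance n} (h : I.Polygonal) {δ : ℝ}
    (hJ : I.Joined δ 0 0 I.mf I.mg) : I.dist ≤ δ := by
  refine le_of_forall_pos_le_add fun ε hε => ?_
  obtain ⟨α, β, cα, mα, cβ, mβ, h0, h1, hf⟩ := hJ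
  have hmf : (0 : ℝ) < I.mf := by exact_mod_cast h.mf_pos
  have hmg : (0 : ℝ) < I.mg := by exact_mod_cast h.mg_pos
  have hu := (isCompact_Icc.prod isCompact_Icc).uniformContinuousOn_of_continuous
    h.dist_continuousOn
  obtain ⟨d, hd, hu⟩ := Metric.uniformContinuousOn_iff.1 hu ε hε
  -- Chosen so that a perturbation by `η` times at most `mf + mg` stays strictly below `d`.
  set η := d / (d + I.mf + I.mg) with hη
  have hden : 0 < d + I.mf + I.mg := by positivity
  have η0 : 0 < η := by positivity
  have η1 : η ≤ 1 := (div_le_one hden).2 (by linarith)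
  have ηe : η * (d + I.mf + I.mg) = d := by rw [hη]; field_simp
  have rα := isReparam_perturb cα mα (h0 0 le_rfl).1 (h1 1 le_rfl).1 hmf η0 η1
  have rβ := isReparam_perturb cβ mβ (h0 0 le_rfl).2 (h1 1 le_rfl).2 hmg η0 η1
  have close : ∀ {γ m θ : ℝ}, γ ∈ Icc 0 m → θ ∈ Icc (0 : ℝ) 1 → 0 < m → m ≤ I.mf + I.mg →
      |(1 - η) * γ + η * (m * θ) - γ| < d := by
    intro γ m θ hγ hθ hm hle
    have e : (1 - η) * γ + η * (m * θ) - γ = η * (m * θ - γ) := by ring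
    have e1 : m * θ ≤ m := by nlinarith [hθ.2]
    have e2 : 0 ≤ m * θ := mul_nonneg hm.le hθ.1
    have e3 : |m * θ - γ| ≤ m := abs_le.2 ⟨by linarith [hγ.2], by linarith [hγ.1]⟩
    rw [e, abs_mul, abs_of_pos η0]
    nlinarith
  refine dist_le_of_reparam h rα rβ fun θ hθ => ?_
  have mem : ∀ {γ : ℝ → ℝ} {m : ℝ}, Monotone γ → γ 0 = 0 → γ 1 = m → γ θ ∈ Icc 0 m := by
    intro γ m hm e0 e1
    rw [← e0, ← e1]
    exact ⟨hm hθ.1, hm hθ.2⟩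
  have kα := mem mα (h0 0 le_rfl).1 (h1 1 le_rfl).1
  have kβ := mem mβ (h0 0 le_rfl).2 (h1 1 le_rfl).2
  have := hu (_, _) ⟨rα.2.2.1 hθ, rβ.2.2.1 hθ⟩ (α θ, β θ) ⟨kα, kβ⟩ (by
    rw [Prod.dist_eq, Real.dist_eq, Real.dist_eq]
    exact max_lt (close kα hθ hmf (by linarith)) (close kβ hθ hmg (by linarith)))
  rw [Real.dist_eq] at this
  have := (abs_lt.1 this).2
  have := hf θ
  dsimp only at *
  linarith

/-! ## From reparametrizations to reachability -/

lemma Instance.rowOK_of_crossings {I : Instance n} {δ : ℝ} {y : ℕ → ℝ}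
    (hy : ∀ p ≤ I.mf, I.χ (I.f p - I.g (y p)) ≤ δ)
    (my : ∀ p q, p ≤ q → q ≤ I.mf → y p ≤ y q) {i k j : ℕ} (hk : k ≤ I.mf)
    (hlo : ∀ p, i < p → p ≤ k → (j : ℝ) ≤ y p) (hhi : y k ≤ j + 1) : I.RowOK δ i k j := by
  have mem : ∀ p, i < p → p ≤ k → y p ∈ I.edge δ p j := fun p hp hpk =>
    mem_edge_iff.2 ⟨⟨hlo p hp hpk, (my p k hpk hk).trans hhi⟩, hy p (by omega)⟩
  intro p q hp hpq hqk
  exact ⟨y p, mem p hp (by omega), y q, mem q (by omega) hqk, my p q hpq (by omega)⟩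

/-- Here `y p` is the height at which the path crosses the vertical line `p`, and `x q` the abscissa
at which it crosses the horizontal line `q`. The proof follows the path backwards from a cell to the
edge through which it entered the current row or column. -/
lemma Instance.reachEnd_of_crossings {I : Instance n} (h : I.Polygonal) {δ : ℝ} {x y : ℕ → ℝ}
    (hx : ∀ q ≤ I.mg, I.χ (I.f (x q) - I.g q) ≤ δ)
    (hy : ∀ p ≤ I.mf, I.χ (I.f p - I.g (y p)) ≤ δ)
    (mx : ∀ p q, p < q → q ≤ I.mg → x p < x q) (my : ∀ p q, p < q → q ≤ I.mf → y p < y q)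
    (x0 : x 0 = 0) (y0 : y 0 = 0) (x1 : x I.mg = I.mf) (y1 : y I.mf = I.mg)
    (cross : ∀ p ≤ I.mf, ∀ q ≤ I.mg, (y p < q ↔ p < x q)) : I.ReachEnd δ := by
  have mx' : ∀ p q, p ≤ q → q ≤ I.mg → x p ≤ x q := fun p q hpq hq => by
    rcases hpq.eq_or_lt with rfl | hlt
    · exact le_rfl
    · exact (mx p q hlt hq).le
  have my' : ∀ p q, p ≤ q → q ≤ I.mf → y p ≤ y q := fun p q hpq hq => by
    rcases hpq.eq_or_lt with rfl | hlt
    · exact le_rfl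
    · exact (my p q hlt hq).le
  have hxs : ∀ q ≤ I.swap.mf, I.swap.χ (I.swap.f q - I.swap.g (x q)) ≤ δ := fun q hq => by
    rw [map_sub_rev]
    exact hx q hq
  -- Left edges are half-open at the top and bottom edges half-open at the left. A path through a
  -- grid vertex is thereby read as going up first and then right, which makes the choice of
  -- predecessor consistent.
  have key : ∀ N i j, i + j = N → i < I.mf → j < I.mg →
      ((j : ℝ) ≤ y i → y i < j + 1 → I.Reach δ false i j) ∧
      ((i : ℝ) < x j → x j ≤ i + 1 → I.Reach δ true j i) := by
    intro N
    induction N using Nat.strong_induction_on with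
    | _ N ih =>
    intro i j hN hi hj
    constructor
    · intro hlo hhi
      rcases Nat.eq_zero_or_pos i with rfl | hip
      · rw [y0] at hlo
        obtain rfl : j = 0 := by exact_mod_cast le_antisymm hlo (Nat.cast_nonneg j)
        exact .start _
      rcases Nat.eq_zero_or_pos j with rfl | hjp
      · refine .step false 0 i 0 (.start _) hip ?_
        refine rowOK_of_crossings hy my' hi.le (fun p hp hpi => ?_) hhi.le
        have := my 0 p hp (by omega)
        rw [y0] at this
        simpa using this.le
      · have xpos : 0 < x j := by simpa [x0] using mx 0 j hjp hj.le
        have xle : x j ≤ i := not_lt.1 fun hlt => hlo.not_gt ((cross i hi.le j hj.le).2 hlt)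
        -- The path entered row `j` at abscissa `x j`, hence from below into the cell with `i' < x j
        -- ≤ i' + 1`. The run along the row starts there.
        obtain ⟨i', hi'⟩ : ∃ i', ⌈x j⌉₊ = i' + 1 :=
          Nat.exists_eq_succ_of_ne_zero (Nat.ceil_pos.2 xpos).ne'
        have l1 : (i' : ℝ) < x j := Nat.lt_ceil.1 (by omega)
        have l2 : x j ≤ i' + 1 := by
          have := Nat.le_ceil (x j); rw [hi'] at this; exact_mod_cast this
        have l3 : i' < i := by exact_mod_cast l1.trans_le xle
        refine .step false i' i j ((ih (i' + j) (by omega) i' j rfl (by omega) hj).2 l1 l2) l3 ?_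
        refine rowOK_of_crossings hy my' hi.le (fun p hp hpi => ?_) hhi.le
        refine not_lt.1 fun hlt => ?_
        have := (cross p (by omega) j hj.le).1 hlt
        have : (i' : ℝ) + 1 ≤ p := by exact_mod_cast hp
        linarith
    · intro hlo hhi
      have hjp : 0 < j := by
        rcases Nat.eq_zero_or_pos j with rfl | hjp
        · rw [x0] at hlo
          exact absurd hlo (Nat.cast_nonneg i).not_gt
        · exact hjp
      have ylt : y i < j := (cross i hi.le j hj.le).2 hlo
      have ynn : 0 ≤ y i := by simpa [y0] using my' 0 i (Nat.zero_le _) hi.le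
      have l1 := Nat.floor_le ynn
      have l2 := Nat.lt_floor_add_one (y i)
      have l3 : ⌊y i⌋₊ < j := by exact_mod_cast l1.trans_lt ylt
      refine .step true ⌊y i⌋₊ j i
        ((ih (i + ⌊y i⌋₊) (by omega) i ⌊y i⌋₊ rfl hi (by omega)).1 l1 l2) l3 ?_
      refine rowOK_of_crossings (I := I.swap) hxs mx' hj.le (fun q hq hqj => ?_) hhi
      refine ((cross i hi.le q (by omega)).1 (l2.trans_le ?_)).le
      exact_mod_cast hq
  have hf := h.mf_pos
  have hg := h.mg_pos
  have ef : ((I.mf - 1 : ℕ) : ℝ) + 1 = I.mf := by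
    have := Nat.sub_add_cancel hf; exact_mod_cast this
  have eg : ((I.mg - 1 : ℕ) : ℝ) + 1 = I.mg := by
    have := Nat.sub_add_cancel hg; exact_mod_cast this
  have k := key _ (I.mf - 1) (I.mg - 1) rfl (by omega) (by omega)
  rcases le_or_gt (((I.mg - 1 : ℕ) : ℝ)) (y (I.mf - 1)) with hle | hlt
  · refine .inl (k.1 hle ?_)
    have := my (I.mf - 1) I.mf (by omega) le_rfl
    linarith
  · refine .inr (k.2 ((cross _ (by omega) _ (by omega)).1 hlt) ?_)
    have := mx (I.mg - 1) I.mg (by omega) le_rfl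
    linarith

/-- Strict monotonicity makes `α` and `β` injective, so the crossings are `α ∘ β⁻¹` and `β ∘ α⁻¹` at
the integers. Comparing the parameters of two crossings gives the equivalence `cross`. -/
lemma Instance.reachEnd_of_reparam {I : Instance n} (h : I.Polygonal) {α β : ℝ → ℝ}
    (hα : IsReparam 0 I.mf α) (hβ : IsReparam 0 I.mg β) {δ : ℝ}
    (hδ : ∀ θ ∈ Icc (0 : ℝ) 1, I.χ (I.f (α θ) - I.g (β θ)) ≤ δ) :
    I.ReachEnd δ ∧ I.χ (I.f 0 - I.g 0) ≤ δ ∧ I.χ (I.f I.mf - I.g I.mg) ≤ δ := by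
  have ends : ∀ {γ : ℝ → ℝ} {m : ℝ}, IsReparam 0 m γ → 0 ≤ m → γ 0 = 0 ∧ γ 1 = m := by
    intro γ m hγ hm
    have i0 : (0 : ℝ) ∈ Icc (0 : ℝ) 1 := by simp
    have i1 : (1 : ℝ) ∈ Icc (0 : ℝ) 1 := by simp
    obtain ⟨s, hs, es⟩ := hγ.2.2.2.2 (left_mem_Icc.2 hm)
    obtain ⟨t, ht, et⟩ := hγ.2.2.2.2 (right_mem_Icc.2 hm)
    constructor
    · exact le_antisymm (es ▸ hγ.2.1.monotoneOn i0 hs hs.1) (hγ.2.2.1 i0).1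
    · exact le_antisymm (hγ.2.2.1 i1).2 (et ▸ hγ.2.1.monotoneOn ht i1 ht.2)
  obtain ⟨α0, α1⟩ := ends hα (Nat.cast_nonneg _)
  obtain ⟨β0, β1⟩ := ends hβ (Nat.cast_nonneg _)
  have pre : ∀ {γ : ℝ → ℝ} {m : ℕ}, IsReparam 0 m γ → ∀ p : ℕ, ∃ s, p ≤ m →
      s ∈ Icc (0 : ℝ) 1 ∧ γ s = p := by
    intro γ m hγ p
    by_cases hp : p ≤ m
    · obtain ⟨s, hs, es⟩ := hγ.2.2.2.2 (show (p : ℝ) ∈ Icc 0 (m : ℝ) from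
        ⟨Nat.cast_nonneg _, by exact_mod_cast hp⟩)
      exact ⟨s, fun _ => ⟨hs, es⟩⟩
    · exact ⟨0, fun h => absurd h hp⟩
  choose s hs using pre hα
  choose t ht using pre hβ
  have i0 : (0 : ℝ) ∈ Icc (0 : ℝ) 1 := by simp
  have i1 : (1 : ℝ) ∈ Icc (0 : ℝ) 1 := by simp
  have s0 : s 0 = 0 := hα.2.1.injOn (hs 0 (Nat.zero_le _)).1 i0 (by
    rw [(hs 0 (Nat.zero_le _)).2, α0, Nat.cast_zero])
  have t0 : t 0 = 0 := hβ.2.1.injOn (ht 0 (Nat.zero_le _)).1 i0 (by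
    rw [(ht 0 (Nat.zero_le _)).2, β0, Nat.cast_zero])
  have s1 : s I.mf = 1 := hα.2.1.injOn (hs _ le_rfl).1 i1 (by rw [(hs _ le_rfl).2, α1])
  have t1 : t I.mg = 1 := hβ.2.1.injOn (ht _ le_rfl).1 i1 (by rw [(ht _ le_rfl).2, β1])
  refine ⟨reachEnd_of_crossings h (x := fun q => α (t q)) (y := fun p => β (s p)) ?_ ?_ ?_ ?_
    (by simp [t0, α0]) (by simp [s0, β0]) (by simp [t1, α1]) (by simp [s1, β1]) ?_, ?_, ?_⟩
  · intro q hq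
    have := hδ _ (ht q hq).1
    rwa [(ht q hq).2] at this
  · intro p hp
    have := hδ _ (hs p hp).1
    rwa [(hs p hp).2] at this
  · intro p q hpq hq
    have hp : p ≤ I.mg := by omega
    rw [hα.2.1.lt_iff_lt (ht p hp).1 (ht q hq).1, ← hβ.2.1.lt_iff_lt (ht p hp).1 (ht q hq).1,
      (ht p hp).2, (ht q hq).2]
    exact_mod_cast hpq
  · intro p q hpq hq
    have hp : p ≤ I.mf := by omega
    rw [hβ.2.1.lt_iff_lt (hs p hp).1 (hs q hq).1, ← hα.2.1.lt_iff_lt (hs p hp).1 (hs q hq).1,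
      (hs p hp).2, (hs q hq).2]
    exact_mod_cast hpq
  · intro p hp q hq
    rw [← (ht q hq).2, hβ.2.1.lt_iff_lt (hs p hp).1 (ht q hq).1,
      ← hα.2.1.lt_iff_lt (hs p hp).1 (ht q hq).1, (hs p hp).2]
  · have := hδ 0 i0
    rwa [α0, β0] at this
  · have := hδ 1 i1
    rwa [α1, β1] at this

/-- The Fréchet distance is the least value for which the last cell is reached and both
endpoint values are respected. -/
lemma Instance.isLeast_dist {I : Instance n} (h : I.Polygonal) {v : ℝ}
    (hv : I.ReachEnd v) (hmin : ∀ δ, 0 ≤ δ → I.ReachEnd δ → v ≤ δ) :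
    I.dist = max (max (I.critical .startPoint) (I.critical .endPoint)) v := by
  apply le_antisymm
  · set δ := max (max (I.critical .startPoint) (I.critical .endPoint)) v
    have hv' : I.ReachEnd δ := hv.imp (.mono (le_max_right _ _)) (.mono (le_max_right _ _))
    exact (hv'.joined h (le_trans (le_max_left _ _) (le_max_left _ _))
      (le_trans (le_max_right _ _) (le_max_left _ _))).dist_le h
  · have hmf : (0 : ℝ) < I.mf := by exact_mod_cast h.mf_pos
    have hmg : (0 : ℝ) < I.mg := by exact_mod_cast h.mg_pos
    -- The set of admissible values must be shown nonempty before its infimum can be bounded below;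
    -- the constant-speed parametrizations (`η = 1`) provide an element.
    have rep : ∀ {m : ℝ}, 0 < m → ∃ α, IsReparam 0 m α := fun {m} hm =>
      ⟨_, isReparam_perturb (α := fun θ => m * θ) (by fun_prop)
        (fun _ _ h => mul_le_mul_of_nonneg_left h hm.le) (by simp) (by simp) hm one_pos le_rfl⟩
    obtain ⟨α, hα⟩ := rep hmf
    obtain ⟨β, hβ⟩ := rep hmg
    obtain ⟨r, hr⟩ := h.exists_isGreatest hα hβ
    refine le_csInf ⟨r, α, β, hα, hβ, hr⟩ ?_
    rintro r ⟨α, β, hα, hβ, hr⟩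
    obtain ⟨hreach, h0, h1⟩ := reachEnd_of_reparam h hα hβ fun θ hθ => hr.2 ⟨θ, hθ, rfl⟩
    exact max_le (max_le h0 h1) (hmin r ((apply_nonneg I.χ _).trans h0) hreach)

/-! ## Reasoning about programs -/

/-- Started in `s`, the program `c` halts within time `T` in a state with the property `Q`. -/
def Runs (I : Instance n) (H P : ℕ) (c : Prog) (s : State) (T : ℕ) (Q : State → Prop) : Prop :=
  ∃ s' t, Exec I H P c s s' t ∧ t ≤ T ∧ Q s'

section Runs

variable {I : Instance n} {H P : ℕ} {s : State} {T : ℕ} {Q : State → Prop}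

lemma Runs.mono {c : Prog} {T' : ℕ} {Q' : State → Prop} (h : Runs I H P c s T' Q') (hT : T' ≤ T)
    (hQ : ∀ s, Q' s → Q s) : Runs I H P c s T Q := by
  obtain ⟨s', t, he, ht, hq⟩ := h
  exact ⟨s', t, he, ht.trans hT, hQ _ hq⟩

lemma Runs.setNat {arr : ℕ} {idx e : NExp} (hQ : Q (s.setNat arr (idx.eval s) (e.eval s)))
    (hT : idx.cost + e.cost + 1 ≤ T) : Runs I H P (.setNat arr idx e) s T Q :=
  ⟨_, _, .setNat s arr idx e, hT, hQ⟩

lemma Runs.setReal {arr : ℕ} {idx : NExp} {e : RExp}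
    (hQ : Q (s.setReal arr (idx.eval s) (e.eval s)))
    (hT : idx.cost + e.cost + 1 ≤ T) : Runs I H P (.setReal arr idx e) s T Q :=
  ⟨_, _, .setReal s arr idx e, hT, hQ⟩

lemma Runs.critical {arr : ℕ} {idx : NExp} {q : Critical NExp}
    (hq : (q.eval s).Valid I.mf I.mg)
    (hQ : Q (s.setReal arr (idx.eval s) (I.critical (q.eval s))))
    (hT : idx.cost + q.cost + P ≤ T) : Runs I H P (.critical arr idx q) s T Q :=
  ⟨_, _, .critical s arr idx q hq, hT, hQ⟩

lemma Runs.cell {narr rarr : ℕ} {i j : NExp} {δ : RExp} (hi : i.eval s < I.mf)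
    (hj : j.eval s < I.mg)
    (hQ : Q (s.setCell narr rarr (I.cellParam (δ.eval s) (i.eval s) (j.eval s))))
    (hT : i.cost + j.cost + δ.cost + H ≤ T) : Runs I H P (.cell narr rarr i j δ) s T Q :=
  ⟨_, _, .cell s narr rarr i j δ hi hj, hT, hQ⟩

lemma Runs.seq {c d : Prog} {T₁ T₂ : ℕ}
    (h : Runs I H P c s T₁ fun s' => Runs I H P d s' T₂ Q) (hT : T₁ + T₂ ≤ T) :
    Runs I H P (.seq c d) s T Q := by
  obtain ⟨s', t, he, ht, s'', u, he', hu, hq⟩ := h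
  exact ⟨s'', _, .seq c d s s' s'' t u he he', by omega, hq⟩

lemma Runs.seq_mid {c d : Prog} {T₁ T₂ : ℕ} {M : State → Prop} (h : Runs I H P c s T₁ M)
    (h' : ∀ s', M s' → Runs I H P d s' T₂ Q) (hT : T₁ + T₂ ≤ T) :
    Runs I H P (.seq c d) s T Q :=
  Runs.seq (h.mono le_rfl h') hT

lemma Runs.ite {b : Test} {c d : Prog} {T₁ : ℕ} (h1 : b.Holds s → Runs I H P c s T₁ Q)
    (h2 : ¬ b.Holds s → Runs I H P d s T₁ Q) (hT : b.cost + T₁ ≤ T) :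
    Runs I H P (.ite b c d) s T Q := by
  by_cases hb : b.Holds s
  · obtain ⟨s', t, he, ht, hq⟩ := h1 hb
    exact ⟨s', _, .iteTrue b c d s s' t hb he, by omega, hq⟩
  · obtain ⟨s', t, he, ht, hq⟩ := h2 hb
    exact ⟨s', _, .iteFalse b c d s s' t hb he, by omega, hq⟩

/-- The scalar variable `v`. -/
def scalar (v : ℕ) : NExp := .load v (.const 0)

/-- `for v < e do c`. -/
def forLoop (v : ℕ) (e : NExp) (c : Prog) : Prog :=
  .seq (.setNat v (.const 0) (.const 0))
    (.loop (.natLE (.add (scalar v) (.const 1)) e)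
      (.seq c (.setNat v (.const 0) (.add (scalar v) (.const 1)))))

@[simp] lemma scalar_eval (v : ℕ) : (scalar v).eval s = s.nats v 0 := rfl

@[simp] lemma State.setNat_nats_self {v i x : ℕ} : (s.setNat v i x).nats v i = x := by
  simp [State.setNat]

lemma State.setNat_nats_of_ne {v v' i x : ℕ} (h : v' ≠ v) :
    (s.setNat v i x).nats v' = s.nats v' := by
  simp [State.setNat, h]

@[simp] lemma State.setReal_nats {r i : ℕ} {x : ℝ} : (s.setReal r i x).nats = s.nats := rfl

@[simp] lemma State.setReal_reals_self {r i : ℕ} {x : ℝ} :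
    (s.setReal r i x).reals r = Function.update (s.reals r) i x := by
  simp [State.setReal]

lemma State.setReal_reals_of_ne {r r' i : ℕ} {x : ℝ} (h : r' ≠ r) :
    (s.setReal r i x).reals r' = s.reals r' := by
  simp [State.setReal, h]

/-- Induction on the number `d` of remaining rounds. By `hset` the invariant is insensitive to the
counter, so the increment preserves it; the `30` covers the test and the increment. -/
lemma Runs.loop_of_inv {v N B : ℕ} {e : NExp} {c : Prog} {Inv : ℕ → State → Prop}
    (hset : ∀ k s x, Inv k s → Inv k (s.setNat v 0 x))
    (he : ∀ k s, Inv k s → e.eval s = N) (hec : e.cost ≤ 10)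
    (hb : ∀ k < N, ∀ s, Inv k s → s.nats v 0 = k →
      Runs I H P c s B fun s' => s'.nats v 0 = k ∧ Inv (k + 1) s') :
    ∀ d k s, k + d = N → Inv k s → s.nats v 0 = k →
      Runs I H P (.loop (.natLE (.add (scalar v) (.const 1)) e)
        (.seq c (.setNat v (.const 0) (.add (scalar v) (.const 1))))) s (d * (B + 30) + 20)
        (Inv N) := by
  intro d
  induction d with
  | zero =>
    intro k s hk hi hv
    refine ⟨s, _, .loopStop _ _ s ?_, ?_, ?_⟩
    · simp [Test.Holds, NExp.eval, he k s hi, hv]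
      omega
    · simp [Test.cost, NExp.cost, scalar]
      omega
    · obtain rfl : k = N := by omega
      exact hi
  | succ d ih =>
    intro k s hk hi hv
    obtain ⟨s', t, hex, ht, hv', hi'⟩ := hb k (by omega) s hi hv
    obtain ⟨s'', u, hex', hu, hq⟩ := ih (k + 1) (s'.setNat v 0 (k + 1)) (by omega)
      (hset _ _ _ hi') (by simp)
    have hstep := Exec.setNat (I := I) (H := H) (P := P) s' v (.const 0)
      (.add (scalar v) (.const 1))
    simp only [NExp.eval, scalar_eval, hv'] at hstep
    refine ⟨s'', _, .loopStep _ _ s _ s'' _ _ ?_ (.seq _ _ _ _ _ _ _ hex hstep) hex', ?_, hq⟩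
    · simp [Test.Holds, NExp.eval, he k s hi, hv]
      omega
    · simp only [Test.cost, NExp.cost, scalar]
      rw [Nat.succ_mul]
      omega

lemma Runs.forLoop {v : ℕ} (N B : ℕ) {e : NExp} {c : Prog} (Inv : ℕ → State → Prop)
    (h0 : Inv 0 s) (hset : ∀ k s x, Inv k s → Inv k (s.setNat v 0 x))
    (he : ∀ k s, Inv k s → e.eval s = N) (hec : e.cost ≤ 10)
    (hb : ∀ k < N, ∀ s, Inv k s → s.nats v 0 = k →
      Runs I H P c s B fun s' => s'.nats v 0 = k ∧ Inv (k + 1) s')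
    (hT : (N + 1) * (B + 30) ≤ T) (hQ : ∀ s, Inv N s → Q s) :
    Runs I H P (forLoop v e c) s T Q := by
  refine Runs.seq (T₁ := 3) (T₂ := N * (B + 30) + 20)
    (Runs.setNat ?_ (by simp [NExp.cost])) ?_
  · exact (Runs.loop_of_inv hset he hec hb N 0 _ (by omega) (hset _ _ _ h0)
      (by simp [NExp.eval])).mono le_rfl hQ
  · rw [Nat.succ_mul] at hT
    omega

/-- An injective code for pairs. -/
def pairCode (a b : ℕ) : ℕ := (a + b) * (a + b) + a

/-- An expression for the code of a pair. -/
def pairExp (a b : NExp) : NExp := .add (.mul (.add a b) (.add a b)) a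

/-- The code lies between the square of `a + b` and the next square, so it determines `a + b` and
then `a`. -/
lemma pairCode_inj {a b a' b' : ℕ} : pairCode a b = pairCode a' b' ↔ a = a' ∧ b = b' := by
  constructor
  · intro h
    unfold pairCode at h
    have e : a + b = a' + b' := by
      rcases lt_trichotomy (a + b) (a' + b') with hl | he | hl
      · nlinarith
      · exact he
      · nlinarith
    rw [e] at h
    omega
  · rintro ⟨rfl, rfl⟩
    rfl

@[simp] lemma pairExp_eval (a b : NExp) :
    (pairExp a b).eval s = pairCode (a.eval s) (b.eval s) := rfl

/-- The memory differs at most in the given arrays. -/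
structure Frame (ns rs : List ℕ) (s s' : State) : Prop where
  nats : ∀ v, v ∉ ns → s'.nats v = s.nats v
  reals : ∀ r, r ∉ rs → s'.reals r = s.reals r

lemma Frame.refl (ns rs : List ℕ) (s : State) : Frame ns rs s s := ⟨fun _ _ => rfl, fun _ _ => rfl⟩

lemma Frame.trans {ns rs ns' rs' : List ℕ} {s₁ s₂ s₃ : State} (h : Frame ns rs s₁ s₂)
    (h' : Frame ns' rs' s₂ s₃) (hn : ns' ⊆ ns) (hr : rs' ⊆ rs) : Frame ns rs s₁ s₃ :=
  ⟨fun v hv => (h'.nats v fun hm => hv (hn hm)).trans (h.nats v hv),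
    fun r hr' => (h'.reals r fun hm => hr' (hr hm)).trans (h.reals r hr')⟩

lemma Frame.setNat {ns rs : List ℕ} {s s' : State} (h : Frame ns rs s s') {v i x : ℕ}
    (hv : v ∈ ns) : Frame ns rs s (s'.setNat v i x) :=
  ⟨fun w hw => (State.setNat_nats_of_ne fun e : w = v => hw (e ▸ hv)).trans (h.nats w hw), h.reals⟩

lemma Frame.setReal {ns rs : List ℕ} {s s' : State} (h : Frame ns rs s s') {r i : ℕ} {x : ℝ}
    (hr : r ∈ rs) : Frame ns rs s (s'.setReal r i x) :=
  ⟨h.nats, fun w hw => (State.setReal_reals_of_ne fun e : w = r => hw (e ▸ hr)).trans (h.reals w hw)⟩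

lemma Frame.setCell {ns rs : List ℕ} {s s' : State} (h : Frame ns rs s s') {v r : ℕ}
    {p : ℕ → Option (ℝ × ℝ)} (hv : v ∈ ns) (hr : r ∈ rs) : Frame ns rs s (s'.setCell v r p) := by
  constructor
  · intro w hw
    have : w ≠ v := fun e => hw (e ▸ hv)
    simpa [State.setCell, this] using h.nats w hw
  · intro w hw
    have : w ≠ r := fun e => hw (e ▸ hr)
    simpa [State.setCell, this] using h.reals w hw

/-! ## The program

Real arrays: `3` receives cell parameters, `4` holds temporary values, `5` and `6` the nearest
points on the left and on the bottom edges, `7` and `8` the costs of runs along rows and columns,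
`9` and `10` the costs of reaching a cell at the end of a run along a row or a column, and `11` an
upper bound. -/

/-- The array of nearest points. -/
def arrX (o : Bool) : ℕ := if o then 6 else 5
/-- The array of costs of runs. -/
def arrR (o : Bool) : ℕ := if o then 8 else 7
/-- The array of costs of reaching a cell. -/
def arrD (o : Bool) : ℕ := if o then 10 else 9

/-- The number of segments of the first curve of the oriented instance. -/
def lim (o : Bool) : NExp := .load 0 (.const (if o then 1 else 0))

/-- Entry values of the oriented instance. -/
def entryC {α : Type} (o : Bool) (k j : α) : Critical α :=
  if o then .entryBottom j k else .entryLeft k j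

/-- Clamped values of the oriented instance. -/
def clampC {α : Type} (o : Bool) (p k j : α) : Critical α :=
  if o then .clampVert j p k else .clampHor p k j

/-- Replace the temporary value `i` by its maximum with `e`. -/
def accMax (i : ℕ) (e : RExp) : Prog :=
  .ite (.realLE (.load 4 (.const i)) e) (.setReal 4 (.const i) e)
    (.setReal 4 (.const i) (.load 4 (.const i)))

/-- Replace the temporary value `i` by its minimum with `e`. -/
def accMin (i : ℕ) (e : RExp) : Prog :=
  .ite (.realLE (.load 4 (.const i)) e) (.setReal 4 (.const i) (.load 4 (.const i)))
    (.setReal 4 (.const i) e)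

/-- Compute a nearest point on every edge. -/
def nearestProg (o : Bool) : Prog :=
  forLoop 1 (lim o) <| forLoop 2 (lim !o) <|
    .seq (.critical 4 (.const 0) (entryC o (scalar 1) (scalar 2))) <|
    .seq (.cell 4 3 (if o then scalar 2 else scalar 1) (if o then scalar 1 else scalar 2)
      (.load 4 (.const 0)))
    -- The lower end of the free interval: position `0` belongs to the bottom edge `0`, position `6`
    -- to the left edge `3`.
    (.setReal (arrX o) (pairExp (scalar 1) (scalar 2)) (.load 3 (.const (if o then 0 else 6))))

/-- Store the pair cost for the edges `p` and `k` of row `j`, with `k - p` in variable `3`. -/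
def pairCostProg (o : Bool) (p k j : NExp) : Prog :=
  .ite (.natLE (scalar 3) (.const 0)) (.critical 4 (.const 0) (entryC o k j))
    (.ite (.realLE (.load (arrX o) (pairExp p j)) (.load (arrX o) (pairExp k j)))
      (.setReal 4 (.const 0) (.ofNat (.const 0)))
      (.critical 4 (.const 0) (clampC o p k j)))

/-- Compute the costs of all runs. -/
def runCostProg (o : Bool) : Prog :=
  let j := scalar 1
  let k := scalar 2
  -- Variable `3` counts down from `k`, so `p` runs through `k, …, 1`, and the entries for `p + 1,
  -- k` and `p, k - 1` precede the one for `p, k`.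
  let p := NExp.sub (scalar 2) (scalar 3)
  forLoop 1 (lim !o) <| forLoop 2 (lim o) <| forLoop 3 (scalar 2) <|
    .seq (pairCostProg o p k j) <|
    .seq (accMax 0 (.load (arrR o) (pairExp (pairExp (.add p (.const 1)) k) j))) <|
    .seq (accMax 0 (.load (arrR o) (pairExp (pairExp p (.sub k (.const 1))) j)))
    (.setReal (arrR o) (pairExp (pairExp p k) j) (.load 4 (.const 0)))

/-- Compute the cost of reaching a cell at the end of a run along a row (column), the number of the
cell being given by the variables `1` and `2`. -/
def relaxProg (o : Bool) : Prog :=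
  let r := scalar (if o then 2 else 1)
  let c := scalar (if o then 1 else 2)
  .seq (.ite (.natLE (.add r c) (.const 0)) (.setReal 4 (.const 0) (.ofNat (.const 0)))
    -- The upper bound in array `11` plays the role of infinity as the start of a minimum.
    (.setReal 4 (.const 0) (.load 11 (.const 0)))) <|
  .seq (forLoop 3 r <|
    .seq (.setReal 4 (.const 1) (.load (arrD !o) (pairExp c (scalar 3)))) <|
    .seq (accMax 1 (.load (arrR o) (pairExp (pairExp (.add (scalar 3) (.const 1)) r) c)))
    (accMin 0 (.load 4 (.const 1))))
  (.setReal (arrD o) (pairExp r c) (.load 4 (.const 0)))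

/-- Compute the costs of reaching all cells. -/
def reachProg : Prog :=
  forLoop 1 (lim false) <| forLoop 2 (lim true) <| .seq (relaxProg false) (relaxProg true)

/-- An upper bound for the cost of the path along the bottom row and the last column. -/
def boundProg : Prog :=
  let a := NExp.sub (lim false) (.const 1)
  let b := NExp.sub (lim true) (.const 1)
  .setReal 11 (.const 0) (.add (.add
    (.load (arrR false) (pairExp (pairExp (.const 1) a) (.const 0)))
    (.load (arrR true) (pairExp (pairExp (.const 1) b) a))) (.ofNat (.const 1)))

/-- Combine the costs of reaching the last cell with the endpoint values. -/
def outputProg : Prog :=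
  let a := NExp.sub (lim false) (.const 1)
  let b := NExp.sub (lim true) (.const 1)
  .seq (.setReal 4 (.const 0) (.load (arrD false) (pairExp a b))) <|
  .seq (accMin 0 (.load (arrD true) (pairExp b a))) <|
  .seq (.critical 4 (.const 1) .startPoint) <|
  .seq (.critical 4 (.const 2) .endPoint) <|
  .seq (accMax 1 (.load 4 (.const 2))) <|
  .seq (accMax 1 (.load 4 (.const 0)))
  (.setReal 0 (.const 0) (.load 4 (.const 1)))

/-- The program that computes the Fréchet distance. -/
def frechetProg : Prog :=
  .seq (nearestProg false) <| .seq (nearestProg true) <|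
  .seq (runCostProg false) <| .seq (runCostProg true) <|
  .seq boundProg <| .seq reachProg outputProg

lemma Runs.accMax {i : ℕ} {e : RExp}
    (hQ : Q (s.setReal 4 i (max (s.reals 4 i) (e.eval s)))) (hT : 2 * e.cost + 12 ≤ T) :
    Runs I H P (accMax i e) s T Q := by
  refine Runs.ite (T₁ := e.cost + 5) (fun h => Runs.setReal ?_ ?_) (fun h => Runs.setReal ?_ ?_) ?_
  · have h' : s.reals 4 i ≤ e.eval s := h
    rwa [max_eq_right h'] at hQ
  · simp [NExp.cost]; omega
  · have h' : ¬ s.reals 4 i ≤ e.eval s := h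
    rwa [max_eq_left (not_le.1 h').le] at hQ
  · simp [NExp.cost, RExp.cost]
  · simp [Test.cost, NExp.cost, RExp.cost]; omega

lemma Runs.accMin {i : ℕ} {e : RExp}
    (hQ : Q (s.setReal 4 i (min (s.reals 4 i) (e.eval s)))) (hT : 2 * e.cost + 12 ≤ T) :
    Runs I H P (accMin i e) s T Q := by
  refine Runs.ite (T₁ := e.cost + 5) (fun h => Runs.setReal ?_ ?_) (fun h => Runs.setReal ?_ ?_) ?_
  · have h' : s.reals 4 i ≤ e.eval s := h
    rwa [min_eq_left h'] at hQ
  · simp [NExp.cost, RExp.cost]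
  · have h' : ¬ s.reals 4 i ≤ e.eval s := h
    rwa [min_eq_right (not_le.1 h').le] at hQ
  · simp [NExp.cost]; omega
  · simp [Test.cost, NExp.cost, RExp.cost]; omega

end Runs

variable {I : Instance n} {H P : ℕ} {s : State}

/-! ## Correctness of the parts of the program -/

/-- The sizes of the curves are stored where the program expects them. -/
def Sized (I : Instance n) (s : State) : Prop := s.nats 0 0 = I.mf ∧ s.nats 0 1 = I.mg

lemma Sized.lim_eval (h : Sized I s) (o : Bool) : (lim o).eval s = (I.orient o).mf := by
  cases o
  · exact h.1
  · exact h.2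

lemma orient_mg (I : Instance n) (o : Bool) : (I.orient (!o)).mf = (I.orient o).mg := by
  cases o <;> rfl

lemma Sized.lim_not_eval (h : Sized I s) (o : Bool) : (lim !o).eval s = (I.orient o).mg := by
  rw [h.lim_eval, orient_mg]

lemma Sized.frame {ns rs : List ℕ} {s' : State} (h : Sized I s) (hf : Frame ns rs s s')
    (h0 : 0 ∉ ns) : Sized I s' := by
  unfold Sized
  rw [hf.nats 0 h0]
  exact h

lemma lim_cost (o : Bool) : (lim o).cost ≤ 10 := by
  simp [lim, NExp.cost]

lemma entryC_eval (o : Bool) (k j : NExp) :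
    (entryC o k j).eval s = entryC o (k.eval s) (j.eval s) := by
  cases o <;> rfl

lemma clampC_eval (o : Bool) (p k j : NExp) :
    (clampC o p k j).eval s = clampC o (p.eval s) (k.eval s) (j.eval s) := by
  cases o <;> rfl

lemma entryC_cost (o : Bool) (k j : NExp) : (entryC o k j).cost = k.cost + j.cost := by
  cases o
  · rfl
  · exact Nat.add_comm _ _

lemma clampC_cost (o : Bool) (p k j : NExp) :
    (clampC o p k j).cost = p.cost + k.cost + j.cost := by
  cases o
  · rfl
  · simp [clampC, Critical.cost]; omega

lemma entryC_valid {o : Bool} {k j : ℕ} (hk : k < (I.orient o).mf) (hj : j < (I.orient o).mg) :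
    (entryC o k j).Valid I.mf I.mg := by
  cases o
  · exact ⟨hk.le, hj⟩
  · exact ⟨hj, hk.le⟩

lemma clampC_valid {o : Bool} {p k j : ℕ} (hp : p < k) (hk : k < (I.orient o).mf)
    (hj : j < (I.orient o).mg) : (clampC o p k j).Valid I.mf I.mg := by
  cases o
  · exact ⟨hp, hk.le, hj⟩
  · exact ⟨hj, hp, hk.le⟩

lemma critical_entryC (o : Bool) (k j : ℕ) :
    I.critical (entryC o k j) = (I.orient o).critical (.entryLeft k j) := by
  cases o <;> rfl

lemma critical_clampC (o : Bool) (p k j : ℕ) :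
    I.critical (clampC o p k j) = (I.orient o).critical (.clampHor p k j) := by
  cases o <;> rfl

/-! ### Nearest points from the cell primitive -/

lemma cellParam_mem {J : Instance n} (h : J.Polygonal) {k j : ℕ} (hj : j < J.mg)
    {S : Set ℝ} (hS : S = J.edge (J.critical (.entryLeft k j)) k j) :
    sInf S ∈ J.edge (J.critical (.entryLeft k j)) k j ∧ S.Nonempty := by
  have hn : S.Nonempty := hS ▸ slab_segDist_nonempty h.g hj _
  have hc : IsCompact S := hS ▸ slab_isCompact h.g hj _ _
  exact ⟨hS.subset (hc.sInf_mem hn), hn⟩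

lemma freeEdge_left (I : Instance n) {δ : ℝ} {k j : ℕ} (hk : k < I.mf) (hj : j < I.mg) :
    I.freeEdge δ k j 3 = I.edge δ k j := by
  ext y
  have hk' : (k : ℝ) ≤ I.mf := by exact_mod_cast hk.le
  have hj' : (j : ℝ) + 1 ≤ I.mg := by exact_mod_cast hj
  rw [Instance.mem_edge_iff]
  constructor
  · rintro ⟨h1, _, _, h2⟩
    exact ⟨h1, h2⟩
  · rintro ⟨h1, h2⟩
    exact ⟨h1, ⟨Nat.cast_nonneg _, hk'⟩, ⟨(Nat.cast_nonneg _).trans h1.1, h1.2.trans hj'⟩, h2⟩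

lemma freeEdge_bottom (I : Instance n) {δ : ℝ} {k j : ℕ} (hk : k < I.mg) (hj : j < I.mf) :
    I.freeEdge δ j k 0 = I.swap.edge δ k j := by
  ext x
  have hk' : (k : ℝ) ≤ I.mg := by exact_mod_cast hk.le
  have hj' : (j : ℝ) + 1 ≤ I.mf := by exact_mod_cast hj
  constructor
  · rintro ⟨h1, _, _, h2⟩
    exact ⟨h1, h2⟩
  · rintro ⟨h1, h2⟩
    exact ⟨h1, ⟨(Nat.cast_nonneg _).trans h1.1, h1.2.trans hj'⟩, ⟨Nat.cast_nonneg _, hk'⟩, h2⟩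

/-- When the primitive is called with `δ` equal to the entry value, every point of the returned
interval is nearest, so its lower end serves. -/
lemma setCell_nearest (h : I.Polygonal) {o : Bool} {k j : ℕ} (hk : k < (I.orient o).mf)
    (hj : j < (I.orient o).mg) (v r : ℕ) :
    (s.setCell v r (I.cellParam ((I.orient o).critical (.entryLeft k j))
      (if o then j else k) (if o then k else j))).reals r (if o then 0 else 6) ∈
      (I.orient o).edge ((I.orient o).critical (.entryLeft k j)) k j := by
  cases o
  · have e := freeEdge_left I (δ := (I.orient false).critical (.entryLeft k j)) hk hj
    obtain ⟨h1, h2⟩ := cellParam_mem (h.orient false) hj e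
    simpa [State.setCell, Instance.cellParam, h2] using h1
  · have e := freeEdge_bottom I (δ := (I.orient true).critical (.entryLeft k j)) hk hj
    obtain ⟨h1, h2⟩ := cellParam_mem (h.orient true) hj e
    simpa [State.setCell, Instance.cellParam, h2] using h1

lemma ite_eval (o : Bool) (a b : NExp) :
    (if o then a else b).eval s = if o then a.eval s else b.eval s := by
  cases o <;> rfl

lemma runs_nearestProg (h : I.Polygonal) (hs : Sized I s) (o : Bool) :
    Runs I H P (nearestProg o) s
      (((I.orient o).mf + 1) * (((I.orient o).mg + 1) * (H + P + 130) + 30)) fun s' =>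
      Frame [1, 2, 4] [3, 4, arrX o] s s' ∧
        (I.orient o).Nearest fun k j => s'.reals (arrX o) (pairCode k j) := by
  set J := I.orient o with hJ
  have hX : arrX o ≠ 3 ∧ arrX o ≠ 4 := by cases o <;> simp [arrX]
  refine Runs.forLoop J.mf ((J.mg + 1) * (H + P + 130))
    (fun K s' => Frame [1, 2, 4] [3, 4, arrX o] s s' ∧ ∀ k j, k < K → j < J.mg →
      s'.reals (arrX o) (pairCode k j) ∈ J.edge (J.critical (.entryLeft k j)) k j)
    ⟨.refl _ _ _, by simp⟩ (fun k s' x hi => ⟨hi.1.setNat (by simp), hi.2⟩)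
    (fun k s' hi => (hs.frame hi.1 (by simp)).lim_eval o) (lim_cost _) ?_ le_rfl
    (fun s' hi => ⟨hi.1, hi.2⟩)
  rintro K hK s₁ ⟨hf₁, hv₁⟩ hk₁
  refine Runs.forLoop J.mg (H + P + 100)
    (fun L s' => Frame [1, 2, 4] [3, 4, arrX o] s s' ∧ s'.nats 1 0 = K ∧
      ∀ k j, (k < K ∧ j < J.mg) ∨ (k = K ∧ j < L) →
      s'.reals (arrX o) (pairCode k j) ∈ J.edge (J.critical (.entryLeft k j)) k j)
    ⟨hf₁, hk₁, fun k j hkj => hv₁ k j (by omega) (by omega)⟩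
    (fun k s' x hi => ⟨hi.1.setNat (by simp), ?_, hi.2.2⟩)
    (fun k s' hi => (hs.frame hi.1 (by simp)).lim_not_eval o) (lim_cost _) ?_ (by ring_nf; omega)
    (fun s' hi => ⟨hi.2.1, hi.1, fun k j hk hj => hi.2.2 k j (by omega)⟩)
  · rw [State.setNat_nats_of_ne (by simp)]
    exact hi.2.1
  rintro L hL s₂ ⟨hf₂, hk₂, hv₂⟩ hl₂
  have hcell : Runs I H P (.cell 4 3 (if o then scalar 2 else scalar 1)
      (if o then scalar 1 else scalar 2) (.load 4 (.const 0)))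
      (s₂.setReal 4 0 (J.critical (.entryLeft K L))) (H + 20) fun s' =>
      Frame [4] [3, 4] s₂ s' ∧ s'.reals 3 (if o then 0 else 6) ∈
        J.edge (J.critical (.entryLeft K L)) K L := by
    refine Runs.cell ?_ ?_ ⟨?_, ?_⟩ ?_
    · cases o <;> simpa [hk₂, hl₂]
    · cases o <;> simpa [hk₂, hl₂]
    · exact ((Frame.refl _ _ _).setReal (by simp)).setCell (by simp) (by simp)
    · have := setCell_nearest (s := s₂.setReal 4 0 (J.critical (.entryLeft K L))) h hK hL 4 3
      simpa [RExp.eval, NExp.eval, ite_eval, hk₂, hl₂] using this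
    · cases o <;> simp [scalar, NExp.cost, RExp.cost] <;> omega
  refine Runs.seq (T₁ := P + 10) (T₂ := H + 80) (Runs.critical ?_ ?_ ?_) (by omega)
  · simpa [entryC_eval, hk₂, hl₂] using entryC_valid hK hL
  · rw [entryC_eval, scalar_eval, scalar_eval, hk₂, hl₂, critical_entryC, ← hJ]
    refine Runs.seq_mid (T₁ := H + 20) (T₂ := 40) hcell (fun s₃ h₃ => ?_) (by omega)
    have e1 : s₃.nats 1 0 = K := by rw [h₃.1.nats 1 (by simp), hk₂]
    have e2 : s₃.nats 2 0 = L := by rw [h₃.1.nats 2 (by simp), hl₂]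
    refine Runs.setReal ⟨e2, ?_, e1, ?_⟩ ?_
    · exact (hf₂.trans h₃.1 (by simp) (by simp)).setReal (by simp)
    · intro k j hkj
      rw [State.setReal_reals_self, pairExp_eval, scalar_eval, scalar_eval, e1, e2]
      by_cases hc : k = K ∧ j = L
      · obtain ⟨rfl, rfl⟩ := hc
        rw [Function.update_self]
        exact h₃.2
      · rw [Function.update_of_ne (by rwa [Ne, pairCode_inj]),
          h₃.1.reals _ (by simpa using hX)]
        exact hv₂ k j (by omega)
    · simp [pairExp, scalar, NExp.cost, RExp.cost]
  · simp [entryC_cost, scalar, NExp.cost]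
    omega

/-- `v` is the cost of passing through the edges `p, …, k` of row `j`. -/
def Instance.RunCost (I : Instance n) (x : ℕ → ℕ → ℝ) (p k j : ℕ) (v : ℝ) : Prop :=
  ∀ δ, v ≤ δ ↔ 0 ≤ δ ∧ ∀ p' q', p ≤ p' → p' ≤ q' → q' ≤ k → I.pairCost x p' q' j ≤ δ

/-! ### Costs of runs -/

lemma Instance.runCost_of_lt {I : Instance n} {x : ℕ → ℕ → ℝ} {p k j : ℕ} (h : k < p) :
    I.RunCost x p k j 0 := fun δ =>
  ⟨fun hδ => ⟨hδ, fun _ _ _ _ _ => by omega⟩, fun hδ => hδ.1⟩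

/-- A pair of edges from `p, …, k` is the outermost pair, or avoids `p`, or avoids `k`. -/
lemma Instance.RunCost.step {I : Instance n} {x : ℕ → ℕ → ℝ} {p k j : ℕ} {v v' : ℝ}
    (hpk : p ≤ k) (hk : 0 < k) (h : I.RunCost x (p + 1) k j v) (h' : I.RunCost x p (k - 1) j v') :
    I.RunCost x p k j (max (max (I.pairCost x p k j) v) v') := by
  intro δ
  rw [max_le_iff, max_le_iff, h δ, h' δ]
  constructor
  · rintro ⟨⟨h1, h0, h2⟩, _, h3⟩
    refine ⟨h0, fun p' q' hp hpq hq => ?_⟩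
    rcases hp.eq_or_lt with rfl | hp
    · rcases hq.eq_or_lt with rfl | hq
      · exact h1
      · exact h3 _ _ le_rfl hpq (by omega)
    · exact h2 _ _ hp hpq hq
  · rintro ⟨h0, h1⟩
    exact ⟨⟨h1 _ _ le_rfl hpk le_rfl, h0, fun p' q' hp hpq hq => h1 _ _ (by omega) hpq hq⟩, h0,
      fun p' q' hp hpq hq => h1 _ _ hp hpq (by omega)⟩

lemma runs_pairCostProg {o : Bool} {p k j : NExp} {p' k' j' : ℕ} (hp : p.eval s = p')
    (hk : k.eval s = k') (hj : j.eval s = j') (hpk : p' ≤ k') (hk' : k' < (I.orient o).mf)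
    (hj' : j' < (I.orient o).mg) (hd : s.nats 3 0 = k' - p') (cp : p.cost ≤ 5) (ck : k.cost ≤ 5)
    (cj : j.cost ≤ 5) :
    Runs I H P (pairCostProg o p k j) s (P + 150) fun s' =>
      s' = s.setReal 4 0 ((I.orient o).pairCost
        (fun a b => s.reals (arrX o) (pairCode a b)) p' k' j') := by
  refine Runs.ite (T₁ := P + 120) (fun h => ?_) (fun h => ?_) ?_
  · have hpk' : p' = k' := by
      simp [Test.Holds, NExp.eval, hd] at h
      omega
    refine Runs.critical ?_ ?_ ?_
    · rw [entryC_eval, hk, hj]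
      exact entryC_valid hk' hj'
    · rw [entryC_eval, hk, hj, critical_entryC, Instance.pairCost, if_pos hpk']
      rfl
    · rw [entryC_cost]
      simp [NExp.cost]
      omega
  · have hpk' : p' ≠ k' := by
      simp [Test.Holds, NExp.eval, hd] at h
      omega
    refine Runs.ite (T₁ := P + 20) (fun h => ?_) (fun h => ?_) ?_
    · have h' : s.reals (arrX o) (pairCode p' j') ≤ s.reals (arrX o) (pairCode k' j') := by
        simpa [Test.Holds, RExp.eval, hp, hk, hj] using h
      refine Runs.setReal ?_ ?_
      · rw [Instance.pairCost, if_neg hpk', if_pos h']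
        simp [RExp.eval, NExp.eval]
      · simp [NExp.cost, RExp.cost]
    · have h' : ¬ s.reals (arrX o) (pairCode p' j') ≤ s.reals (arrX o) (pairCode k' j') := by
        simpa [Test.Holds, RExp.eval, hp, hk, hj] using h
      refine Runs.critical ?_ ?_ ?_
      · rw [clampC_eval, hp, hk, hj]
        exact clampC_valid (by omega) hk' hj'
      · rw [clampC_eval, hp, hk, hj, critical_clampC, Instance.pairCost, if_neg hpk', if_neg h']
        rfl
      · rw [clampC_cost]
        simp [NExp.cost]
        omega
    · simp [Test.cost, RExp.cost, NExp.cost, pairExp]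
      omega
  · simp [Test.cost, NExp.cost, scalar]
    omega

/-- The code of a triple. -/
def tripleCode (a b c : ℕ) : ℕ := pairCode (pairCode a b) c

lemma tripleCode_inj {a b c a' b' c' : ℕ} :
    tripleCode a b c = tripleCode a' b' c' ↔ a = a' ∧ b = b' ∧ c = c' := by
  rw [tripleCode, tripleCode, pairCode_inj, pairCode_inj, and_assoc]

/-- One entry of the table of costs of runs. -/
lemma runs_runCostBody {o : Bool} {p' k' j' : ℕ} (hp' : 1 ≤ p') (hk : s.nats 2 0 = k')
    (hj : s.nats 1 0 = j') (hpk : p' ≤ k') (hk' : k' < (I.orient o).mf)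
    (hj' : j' < (I.orient o).mg) (hd : s.nats 3 0 = k' - p') :
    Runs I H P (.seq (pairCostProg o (.sub (scalar 2) (scalar 3)) (scalar 2) (scalar 1)) <|
    .seq (accMax 0 (.load (arrR o) (pairExp (pairExp (.add (.sub (scalar 2) (scalar 3)) (.const 1))
      (scalar 2)) (scalar 1)))) <|
    .seq (accMax 0 (.load (arrR o) (pairExp (pairExp (.sub (scalar 2) (scalar 3))
      (.sub (scalar 2) (.const 1))) (scalar 1))))
    (.setReal (arrR o) (pairExp (pairExp (.sub (scalar 2) (scalar 3)) (scalar 2)) (scalar 1))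
      (.load 4 (.const 0)))) s (P + 850) fun s' => Frame [] [4, arrR o] s s' ∧
      s'.reals (arrR o) = Function.update (s.reals (arrR o)) (tripleCode p' k' j')
        (max (max ((I.orient o).pairCost
          (fun a b => s.reals (arrX o) (pairCode a b)) p' k' j')
          (s.reals (arrR o) (tripleCode (p' + 1) k' j')))
          (s.reals (arrR o) (tripleCode p' (k' - 1) j'))) := by
  have hR : arrR o ≠ 4 := by cases o <;> simp [arrR]
  have hp : k' - (k' - p') = p' := by omega
  refine Runs.seq_mid (T₁ := P + 150) (T₂ := 700) (runs_pairCostProg (p' := p') (k' := k')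
    (j' := j') ?_ hk hj hpk hk' hj' hd ?_ ?_ ?_) ?_ (by omega)
  · simp [NExp.eval, hk, hd, hp]
  · simp [NExp.cost, scalar]
  · simp [NExp.cost, scalar]
  · simp [NExp.cost, scalar]
  rintro _ rfl
  refine Runs.seq (T₁ := 250) (T₂ := 450) (Runs.accMax ?_ ?_) le_rfl
  · refine Runs.seq (T₁ := 250) (T₂ := 200) (Runs.accMax ?_ ?_) le_rfl
    · refine Runs.setReal ⟨?_, ?_⟩ ?_
      · exact ((((Frame.refl _ _ _).setReal (by simp)).setReal (by simp)).setReal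
          (by simp)).setReal (by simp)
      · simp [RExp.eval, NExp.eval, hk, hj, hd, hp, State.setReal_reals_of_ne hR, tripleCode]
      · simp [NExp.cost, RExp.cost, scalar, pairExp]
    · simp [NExp.cost, RExp.cost, scalar, pairExp]
  · simp [NExp.cost, RExp.cost, scalar, pairExp]

/-- Entries with `k < p` are never written and keep their initial value `0`, which is the correct
cost of an empty run. This is why the table has to be zero at the start. -/
lemma runs_runCostProg (hs : Sized I s) (o : Bool) (hz : ∀ i, s.reals (arrR o) i = 0) :
    Runs I H P (runCostProg o) s
      (((I.orient o).mg + 1) * (((I.orient o).mf + 1) *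
        (((I.orient o).mf + 1) * (P + 880) + 30) + 30)) fun s' =>
      Frame [1, 2, 3] [4, arrR o] s s' ∧ ∀ p k j, 1 ≤ p → k < (I.orient o).mf →
        j < (I.orient o).mg → (I.orient o).RunCost (fun k j => s.reals (arrX o) (pairCode k j))
          p k j (s'.reals (arrR o) (tripleCode p k j)) := by
  set J := I.orient o with hJ
  set x : ℕ → ℕ → ℝ := fun k j => s.reals (arrX o) (pairCode k j) with hx
  have hX : arrX o ∉ [4, arrR o] := by cases o <;> simp [arrX, arrR]
  refine Runs.forLoop J.mg ((J.mf + 1) * ((J.mf + 1) * (P + 880) + 30))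
    (fun A s' => Frame [1, 2, 3] [4, arrR o] s s' ∧ ∀ p k j, 1 ≤ p → k < J.mf → j < J.mg →
      k < p ∨ j < A → J.RunCost x p k j (s'.reals (arrR o) (tripleCode p k j)))
    ⟨.refl _ _ _, fun p k j hp hk hj h => ?_⟩ (fun k s' x hi => ⟨hi.1.setNat (by simp), hi.2⟩)
    (fun k s' hi => (hs.frame hi.1 (by simp)).lim_not_eval o) (lim_cost _) ?_ le_rfl
    (fun s' hi => ⟨hi.1, fun p k j hp hk hj => hi.2 p k j hp hk hj (.inr hj)⟩)
  · rw [hz]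
    exact Instance.runCost_of_lt (by omega)
  rintro A hA s₁ ⟨hf₁, hv₁⟩ hj₁
  refine Runs.forLoop J.mf ((J.mf + 1) * (P + 880))
    (fun B s' => Frame [1, 2, 3] [4, arrR o] s s' ∧ s'.nats 1 0 = A ∧
      ∀ p k j, 1 ≤ p → k < J.mf → j < J.mg → k < p ∨ j < A ∨ (j = A ∧ k < B) →
      J.RunCost x p k j (s'.reals (arrR o) (tripleCode p k j)))
    ⟨hf₁, hj₁, fun p k j hp hk hj h => hv₁ p k j hp hk hj (by omega)⟩
    (fun k s' x hi => ⟨hi.1.setNat (by simp), ?_, hi.2.2⟩)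
    (fun k s' hi => (hs.frame hi.1 (by simp)).lim_eval o) (lim_cost _) ?_ le_rfl
    (fun s' hi => ⟨hi.2.1, hi.1, fun p k j hp hk hj h => hi.2.2 p k j hp hk hj (by omega)⟩)
  · rw [State.setNat_nats_of_ne (by simp)]
    exact hi.2.1
  rintro B hB s₂ ⟨hf₂, hj₂, hv₂⟩ hk₂
  refine Runs.forLoop B (P + 850)
    (fun D s' => Frame [1, 2, 3] [4, arrR o] s s' ∧ s'.nats 1 0 = A ∧ s'.nats 2 0 = B ∧
      ∀ p k j, 1 ≤ p → k < J.mf → j < J.mg →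
        -- For `j = A` and `k = B` the finished entries are those with `p > B - D`.
        k < p ∨ j < A ∨ (j = A ∧ (k < B ∨ (k = B ∧ B < p + D))) →
      J.RunCost x p k j (s'.reals (arrR o) (tripleCode p k j)))
    ⟨hf₂, hj₂, hk₂, fun p k j hp hk hj h => hv₂ p k j hp hk hj (by omega)⟩
    (fun k s' x hi => ⟨hi.1.setNat (by simp), ?_, ?_, hi.2.2.2⟩)
    (fun k s' hi => hi.2.2.1) (by simp [scalar, NExp.cost]) ?_
    (Nat.mul_le_mul_right _ (by omega))
    (fun s' hi => ⟨hi.2.2.1, hi.1, hi.2.1,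
      fun p k j hp hk hj h => hi.2.2.2 p k j hp hk hj (by omega)⟩)
  · rw [State.setNat_nats_of_ne (by simp)]
    exact hi.2.1
  · rw [State.setNat_nats_of_ne (by simp)]
    exact hi.2.2.1
  rintro D hD s₃ ⟨hf₃, hj₃, hk₃, hv₃⟩ hd₃
  refine (runs_runCostBody (p' := B - D) (by omega) hk₃ hj₃ (by omega) hB hA
    (by omega)).mono le_rfl ?_
  rintro s₄ ⟨hf₄, hv₄⟩
  refine ⟨by rw [hf₄.nats 3 (by simp), hd₃], hf₃.trans hf₄ (by simp) (by simp),
    by rw [hf₄.nats 1 (by simp), hj₃], by rw [hf₄.nats 2 (by simp), hk₃], ?_⟩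
  intro p k j hp hk hj hdone
  rw [hv₄]
  by_cases hc : p = B - D ∧ k = B ∧ j = A
  · obtain ⟨rfl, rfl, rfl⟩ := hc
    rw [Function.update_self, hf₃.reals _ hX]
    exact Instance.RunCost.step (by omega) (by omega)
      (hv₃ _ _ _ (by omega) hk hj (by omega)) (hv₃ _ _ _ hp (by omega) hj (by omega))
  · rw [Function.update_of_ne (by rwa [Ne, tripleCode_inj])]
    exact hv₃ p k j hp hk hj (by omega)

/-- Below the bound `b`, the value `v` is the cost of reaching a cell at the end of a run along a
row or a column. -/
def Instance.ReachCost (I : Instance n) (b : ℝ) (o : Bool) (r c : ℕ) (v : ℝ) : Prop :=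
  ∀ δ < b, v ≤ δ ↔ 0 ≤ δ ∧ I.Reach δ o r c

/-- The stored values are the costs of all runs. -/
def RunTable (I : Instance n) (o : Bool) (t : ℕ → ℝ) : Prop :=
  ∀ i k j, k < (I.orient o).mf → j < (I.orient o).mg → ∀ δ,
    t (tripleCode (i + 1) k j) ≤ δ ↔ 0 ≤ δ ∧ (I.orient o).RowOK δ i k j

/-- The loop takes the minimum, over the start `i` of the last run, of the larger of the cost of
reaching that start and the cost of the run. `Instance.reach_iff` reads this minimum as
reachability. -/
lemma runs_relaxProg (o : Bool) {r c : ℕ} {b : ℝ}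
    (hr : s.nats (if o then 2 else 1) 0 = r) (hc : s.nats (if o then 1 else 2) 0 = c)
    (hrl : r < (I.orient o).mf) (hcl : c < (I.orient o).mg) (hb : s.reals 11 0 = b)
    (hR : RunTable I o (s.reals (arrR o)))
    (hD : ∀ i < r, I.ReachCost b (!o) c i (s.reals (arrD !o) (pairCode c i))) :
    Runs I H P (relaxProg o) s ((r + 1) * 450 + 70) fun s' =>
      Frame [3] [4, arrD o] s s' ∧ ∃ v, I.ReachCost b o r c v ∧
        s'.reals (arrD o) = Function.update (s.reals (arrD o)) (pairCode r c) v := by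
  have hn : (if o then 2 else 1) ∉ [3] ∧ (if o then 1 else 2) ∉ [3] := by cases o <;> simp
  have hDn : arrD o ∉ [4] := by cases o <;> simp [arrD]
  have hDm : arrD (!o) ∉ [4] := by cases o <;> simp [arrD]
  have hRn : arrR o ∉ [4] := by cases o <;> simp [arrR]
  refine Runs.seq_mid (T₁ := 20) (T₂ := (r + 1) * 450 + 50)
    -- Below `b` the start value encodes reachability with no run at all: `0` for the first cell,
    -- and `b`, which no `δ < b` attains, for the others.
    (M := fun s' => Frame [3] [4] s s' ∧ ∀ δ < b, s'.reals 4 0 ≤ δ ↔ 0 ≤ δ ∧ r = 0 ∧ c = 0)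
    ?_ ?_ (by omega)
  · refine Runs.ite (T₁ := 5) (fun h => Runs.setReal ⟨?_, ?_⟩ ?_)
      (fun h => Runs.setReal ⟨?_, ?_⟩ ?_) ?_
    · exact (Frame.refl _ _ _).setReal (by simp)
    · have : r = 0 ∧ c = 0 := by
        simpa [Test.Holds, NExp.eval, hr, hc] using h
      simp [NExp.eval, RExp.eval, this]
    · simp [NExp.cost, RExp.cost]
    · exact (Frame.refl _ _ _).setReal (by simp)
    · have : ¬ (r = 0 ∧ c = 0) := by
        simpa [Test.Holds, NExp.eval, hr, hc] using h
      intro δ hδ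
      simp [NExp.eval, RExp.eval, this, hb, hδ]
    · simp [NExp.cost, RExp.cost]
    · simp [Test.cost, NExp.cost, scalar]
  rintro s₁ ⟨hf₁, hv₁⟩
  refine Runs.seq_mid (T₁ := (r + 1) * 450) (T₂ := 50)
    (M := fun s' => Frame [3] [4] s s' ∧ I.ReachCost b o r c (s'.reals 4 0)) ?_ ?_ le_rfl
  · refine Runs.forLoop r 420 (fun K s' => Frame [3] [4] s s' ∧ ∀ δ < b, s'.reals 4 0 ≤ δ ↔ 0 ≤ δ ∧
        ((r = 0 ∧ c = 0) ∨ ∃ i < K, I.Reach δ (!o) c i ∧ (I.orient o).RowOK δ i r c))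
      ⟨hf₁, by simpa using hv₁⟩ (fun k s' x hi => ⟨hi.1.setNat (by simp), hi.2⟩)
      (fun k s' hi => by rw [scalar_eval, hi.1.nats _ hn.1, hr]) (by simp [scalar, NExp.cost])
      ?_ le_rfl ?_
    · rintro K hK s₂ ⟨hf₂, hv₂⟩ hk₂
      have er := (hf₂.nats _ hn.1 ▸ hr : s₂.nats (if o then 2 else 1) 0 = r)
      have ec := (hf₂.nats _ hn.2 ▸ hc : s₂.nats (if o then 1 else 2) 0 = c)
      refine Runs.seq (T₁ := 40) (T₂ := 380) (Runs.setReal ?_ ?_) le_rfl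
      · refine Runs.seq (T₁ := 300) (T₂ := 80) (Runs.accMax ?_ ?_) le_rfl
        · refine Runs.accMin ⟨hk₂, ?_, ?_⟩ ?_
          · exact (((hf₂.setReal (by simp)).setReal (by simp)).setReal (by simp))
          · intro δ hδ
            have e1 := hf₂.reals _ hDm
            have e2 := hf₂.reals _ hRn
            have h4 : arrR o ≠ 4 := by simpa using hRn
            simp only [RExp.eval, NExp.eval, pairExp_eval, scalar_eval, State.setReal_nats,
              State.setReal_reals_self, State.setReal_reals_of_ne h4, er, ec, hk₂, e1, e2,
              Function.update_self, Function.update_of_ne (zero_ne_one' ℕ)]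
            have h1 := hv₂ δ hδ
            have h2 := hD K hK δ hδ
            have h3 := hR K r c hrl hcl δ
            rw [tripleCode] at h3
            rw [min_le_iff, max_le_iff, h1, h2, h3]
            constructor
            · rintro (⟨h0, h | ⟨i, hi, h⟩⟩ | ⟨⟨h0, h⟩, _, h'⟩)
              · exact ⟨h0, .inl h⟩
              · exact ⟨h0, .inr ⟨i, by omega, h⟩⟩
              · exact ⟨h0, .inr ⟨K, by omega, h, h'⟩⟩
            · rintro ⟨h0, h | ⟨i, hi, h⟩⟩
              · exact .inl ⟨h0, .inl h⟩
              · rcases Nat.lt_succ_iff_lt_or_eq.1 hi with hi | rfl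
                · exact .inl ⟨h0, .inr ⟨i, hi, h⟩⟩
                · exact .inr ⟨⟨h0, h.1⟩, h0, h.2⟩
          · simp [NExp.cost, RExp.cost]
        · simp [NExp.cost, RExp.cost, scalar, pairExp]
      · simp [NExp.cost, RExp.cost, scalar, pairExp]
    · rintro s' ⟨hf', hv'⟩
      refine ⟨hf', fun δ hδ => ?_⟩
      rw [hv' δ hδ, Instance.reach_iff]
  · rintro s₂ ⟨hf₂, hv₂⟩
    have er := (hf₂.nats _ hn.1 ▸ hr : s₂.nats (if o then 2 else 1) 0 = r)
    have ec := (hf₂.nats _ hn.2 ▸ hc : s₂.nats (if o then 1 else 2) 0 = c)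
    refine Runs.setReal ⟨?_, s₂.reals 4 0, hv₂, ?_⟩ ?_
    · exact ((Frame.refl _ _ _).trans hf₂ (by simp) (by simp)).setReal (by simp)
    · simp [RExp.eval, NExp.eval, er, ec, hf₂.reals _ hDn]
    · simp [NExp.cost, RExp.cost, scalar, pairExp]

lemma runs_reachProg (hs : Sized I s) {b : ℝ} (hb : s.reals 11 0 = b)
    (hR : ∀ o, RunTable I o (s.reals (arrR o))) :
    Runs I H P reachProg s
      ((I.mf + 1) * ((I.mg + 1) * ((I.mf + I.mg) * 450 + 170) + 30)) fun s' =>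
      Frame [1, 2, 3] [4, 9, 10] s s' ∧ ∀ i j, i < I.mf → j < I.mg →
        I.ReachCost b false i j (s'.reals (arrD false) (pairCode i j)) ∧
        I.ReachCost b true j i (s'.reals (arrD true) (pairCode j i)) := by
  have hRf : ∀ {s' : State}, Frame [1, 2, 3] [4, 9, 10] s s' → ∀ o,
      RunTable I o (s'.reals (arrR o)) := by
    intro s' hf o
    rw [hf.reals _ (by cases o <;> simp [arrR])]
    exact hR o
  have hbf : ∀ {s' : State}, Frame [1, 2, 3] [4, 9, 10] s s' → s'.reals 11 0 = b := by
    intro s' hf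
    rw [hf.reals _ (by simp), hb]
  refine Runs.forLoop I.mf ((I.mg + 1) * ((I.mf + I.mg) * 450 + 170))
    (fun A s' => Frame [1, 2, 3] [4, 9, 10] s s' ∧ ∀ i j, i < A → j < I.mg →
        I.ReachCost b false i j (s'.reals (arrD false) (pairCode i j)) ∧
        I.ReachCost b true j i (s'.reals (arrD true) (pairCode j i)))
    ⟨.refl _ _ _, by simp⟩ (fun k s' x hi => ⟨hi.1.setNat (by simp), hi.2⟩)
    (fun k s' hi => (hs.frame hi.1 (by simp)).lim_eval false) (lim_cost _) ?_ le_rfl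
    (fun s' hi => hi)
  rintro A hA s₁ ⟨hf₁, hv₁⟩ hi₁
  refine Runs.forLoop I.mg ((I.mf + I.mg) * 450 + 140)
    (fun B s' => Frame [1, 2, 3] [4, 9, 10] s s' ∧ s'.nats 1 0 = A ∧ ∀ i j, j < I.mg →
        i < A ∨ (i = A ∧ j < B) →
        I.ReachCost b false i j (s'.reals (arrD false) (pairCode i j)) ∧
        I.ReachCost b true j i (s'.reals (arrD true) (pairCode j i)))
    ⟨hf₁, hi₁, fun i j hj h => hv₁ i j (by omega) hj⟩
    (fun k s' x hi => ⟨hi.1.setNat (by simp), ?_, hi.2.2⟩)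
    (fun k s' hi => (hs.frame hi.1 (by simp)).lim_eval true) (lim_cost _) ?_ le_rfl
    (fun s' hi => ⟨hi.2.1, hi.1, fun i j hi' hj => hi.2.2 i j hj (by omega)⟩)
  · rw [State.setNat_nats_of_ne (by simp)]
    exact hi.2.1
  rintro B hB s₂ ⟨hf₂, hi₂, hv₂⟩ hj₂
  refine Runs.seq_mid (T₁ := (A + 1) * 450 + 70) (T₂ := (B + 1) * 450 + 70)
    (runs_relaxProg (b := b) false hi₂ hj₂ hA hB (hbf hf₂) (hRf hf₂ _)
      fun i hi => (hv₂ i B hB (by omega)).2) ?_ (by omega)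
  rintro s₃ ⟨hf₃, v, hv, hv₃⟩
  have hi₃ : s₃.nats 1 0 = A := by rw [hf₃.nats 1 (by simp), hi₂]
  have hj₃ : s₃.nats 2 0 = B := by rw [hf₃.nats 2 (by simp), hj₂]
  have hf₃' := hf₂.trans hf₃ (by simp) (by simp [arrD])
  have hD₃ : ∀ i j, j < I.mg → i < A ∨ (i = A ∧ j < B + 1) →
      I.ReachCost b false i j (s₃.reals (arrD false) (pairCode i j)) := by
    intro i j hj hij
    rw [hv₃]
    by_cases hc : i = A ∧ j = B
    · obtain ⟨rfl, rfl⟩ := hc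
      rwa [Function.update_self]
    · rw [Function.update_of_ne (by rwa [Ne, pairCode_inj])]
      exact (hv₂ i j hj (by omega)).1
  refine (runs_relaxProg (b := b) true hj₃ hi₃ hB hA (hbf hf₃') (hRf hf₃' _)
    fun j hj => hD₃ A j (by omega) (by omega)).mono le_rfl ?_
  rintro s₄ ⟨hf₄, w, hw, hv₄⟩
  refine ⟨by rw [hf₄.nats 2 (by simp), hj₃], hf₃'.trans hf₄ (by simp) (by simp [arrD]),
    by rw [hf₄.nats 1 (by simp), hi₃], fun i j hj hij => ⟨?_, ?_⟩⟩
  · rw [hf₄.reals _ (by simp [arrD])]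
    exact hD₃ i j hj hij
  · rw [hv₄]
    by_cases hc : j = B ∧ i = A
    · obtain ⟨rfl, rfl⟩ := hc
      rwa [Function.update_self]
    · rw [Function.update_of_ne (by rwa [Ne, pairCode_inj]), hf₃.reals _ (by simp [arrD])]
      exact (hv₂ i j hj (by omega)).2

/-- The path along the bottom row and then the last column has cost at most `x + y`, as both run
costs are nonnegative. The extra `1` puts the bound strictly above the true value, so replacing
infinity by it changes nothing. -/
lemma Instance.dist_eq_of_reachCost (h : I.Polygonal) {x y u v : ℝ}
    (hx : ∀ δ, x ≤ δ ↔ 0 ≤ δ ∧ I.RowOK δ 0 (I.mf - 1) 0)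
    (hy : ∀ δ, y ≤ δ ↔ 0 ≤ δ ∧ I.swap.RowOK δ 0 (I.mg - 1) (I.mf - 1))
    (hu : I.ReachCost (x + y + 1) false (I.mf - 1) (I.mg - 1) u)
    (hv : I.ReachCost (x + y + 1) true (I.mg - 1) (I.mf - 1) v) :
    I.dist = max (max (I.critical .startPoint) (I.critical .endPoint)) (min u v) := by
  have x0 := ((hx x).1 le_rfl).1
  have y0 := ((hy y).1 le_rfl).1
  have hrow := ((hx (x + y)).1 (by linarith)).2
  have hcol := ((hy (x + y)).1 (by linarith)).2
  have hiff : ∀ δ < x + y + 1, min u v ≤ δ ↔ 0 ≤ δ ∧ I.ReachEnd δ := fun δ hδ => by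
    rw [min_le_iff, hu δ hδ, hv δ hδ, ← and_or_left, ReachEnd]
  have hbase : I.Reach (x + y) false (I.mf - 1) 0 := by
    rcases Nat.eq_zero_or_pos (I.mf - 1) with h0 | hpos
    · rw [h0]
      exact .start _
    · exact .step false 0 _ _ (.start _) hpos hrow
  have hend : I.ReachEnd (x + y) := by
    rcases Nat.eq_zero_or_pos (I.mg - 1) with h0 | hpos
    · left
      rw [h0]
      exact hbase
    · exact .inr (.step true 0 _ _ hbase hpos hcol)
  have hle : min u v ≤ x + y := (hiff _ (by linarith)).2 ⟨by linarith, hend⟩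
  -- As `min u v` itself is below the bound, `hiff` applies at `δ = min u v` and shows that the last
  -- cell is reached there.
  refine isLeast_dist h ((hiff _ (by linarith)).1 le_rfl).2 fun δ h0 hr => ?_
  rcases lt_or_ge δ (x + y + 1) with hδ | hδ
  · exact (hiff δ hδ).2 ⟨h0, hr⟩
  · linarith

lemma runs_outputProg (hs : Sized I s) :
    Runs I H P outputProg s (2 * P + 300) fun s' =>
      s'.reals 0 0 = max (max (I.critical .startPoint) (I.critical .endPoint))
        (min (s.reals (arrD false) (pairCode (I.mf - 1) (I.mg - 1)))
          (s.reals (arrD true) (pairCode (I.mg - 1) (I.mf - 1)))) := by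
  refine Runs.seq (T₁ := 60) (T₂ := 2 * P + 240) (Runs.setReal ?_ ?_) (by omega)
  · refine Runs.seq (T₁ := 120) (T₂ := 2 * P + 120) (Runs.accMin ?_ ?_) (by omega)
    · refine Runs.seq (T₁ := P + 5) (T₂ := P + 110) (Runs.critical trivial ?_ ?_) (by omega)
      · refine Runs.seq (T₁ := P + 5) (T₂ := 100) (Runs.critical trivial ?_ ?_) (by omega)
        · refine Runs.seq (T₁ := 20) (T₂ := 80) (Runs.accMax ?_ ?_) le_rfl
          · refine Runs.seq (T₁ := 20) (T₂ := 60) (Runs.accMax ?_ ?_) le_rfl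
            · refine Runs.setReal ?_ ?_
              · have h4 : arrD true ≠ 4 := by simp [arrD]
                simp [RExp.eval, NExp.eval, Critical.eval, State.setReal_reals_of_ne h4, lim]
                rw [hs.1, hs.2]
              · simp [NExp.cost, RExp.cost]
            · simp [NExp.cost, RExp.cost]
          · simp [NExp.cost, RExp.cost]
        · simp [NExp.cost, Critical.cost]
          omega
      · simp [NExp.cost, Critical.cost]
        omega
    · simp [NExp.cost, RExp.cost, pairExp, lim]
  · simp [NExp.cost, RExp.cost, pairExp, lim]

lemma runTable_of_runCost (h : I.Polygonal) {o : Bool} {x : ℕ → ℕ → ℝ}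
    (hx : (I.orient o).Nearest x) {t : ℕ → ℝ}
    (ht : ∀ p k j, 1 ≤ p → k < (I.orient o).mf → j < (I.orient o).mg →
      (I.orient o).RunCost x p k j (t (tripleCode p k j))) : RunTable I o t := by
  intro i k j hk hj δ
  rw [ht (i + 1) k j (by omega) hk hj δ]
  exact and_congr_right fun hδ => (Instance.rowOK_iff (h.orient o) hx hδ hk hj).symm

lemma runs_boundProg (hs : Sized I s) :
    Runs I H P boundProg s 300 fun s' => Frame [] [11] s s' ∧ s'.reals 11 0 =
      s.reals (arrR false) (tripleCode 1 (I.mf - 1) 0) +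
      s.reals (arrR true) (tripleCode 1 (I.mg - 1) (I.mf - 1)) + 1 := by
  refine Runs.setReal ⟨(Frame.refl _ _ _).setReal (by simp), ?_⟩ ?_
  · simp [RExp.eval, NExp.eval, lim, hs.1, hs.2, tripleCode]
  · simp [NExp.cost, RExp.cost, pairExp, lim]

/-! ### Running time and the main theorem -/

lemma total_time_le {a b H P : ℕ} (ha : 1 ≤ a) (hb : 1 ≤ b) (hP : 1 ≤ P) :
    (a + 1) * ((b + 1) * (H + P + 130) + 30) + ((b + 1) * ((a + 1) * (H + P + 130) + 30) +
      ((b + 1) * ((a + 1) * ((a + 1) * (P + 880) + 30) + 30) +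
      ((a + 1) * ((b + 1) * ((b + 1) * (P + 880) + 30) + 30) +
      (300 + ((a + 1) * ((b + 1) * ((a + b) * 450 + 170) + 30) + (2 * P + 300)))))) ≤
    20000 * ((b * a ^ 2 + a * b ^ 2) * P + a * b * H) := by
  have one : ∀ {x y : ℕ}, 1 ≤ x → 1 ≤ y → 1 ≤ x * y := fun hx hy => Nat.mul_pos hx hy
  have near : ∀ a b : ℕ, 1 ≤ a → 1 ≤ b →
      (a + 1) * ((b + 1) * (H + P + 130) + 30) ≤ 4 * (a * b * H) + 584 * (a * b * P) := by
    intro a b ha hb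
    have h := one hb hP
    calc _ ≤ (2 * a) * ((2 * b) * (H + 131 * P) + 30 * (b * P)) := by
          refine Nat.mul_le_mul (by omega) (Nat.add_le_add (Nat.mul_le_mul ?_ ?_) ?_) <;> omega
      _ = _ := by ring
  -- All lower-order terms are absorbed using `1 ≤ a`, `1 ≤ b` and `1 ≤ P`. The run tables dominate;
  -- with the other parts the coefficients stay below `20000`.
  have run : ∀ a b : ℕ, 1 ≤ a → 1 ≤ b →
      (b + 1) * ((a + 1) * ((a + 1) * (P + 880) + 30) + 30) ≤ 7228 * (b * a ^ 2 * P) := by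
    intro a b ha hb
    have h := one ha hP
    have h' := one ha h
    calc _ ≤ (2 * b) * ((2 * a) * ((2 * a) * (881 * P) + 30 * (a * P)) + 30 * (a * (a * P))) := by
          refine Nat.mul_le_mul (by omega) (Nat.add_le_add (Nat.mul_le_mul (by omega)
            (Nat.add_le_add (Nat.mul_le_mul (by omega) (by omega)) ?_)) ?_) <;> omega
      _ = _ := by ring
  have reach : (a + 1) * ((b + 1) * ((a + b) * 450 + 170) + 30) ≤
      2540 * ((b * a ^ 2 + a * b ^ 2) * P) := by
    have h := one (x := a + b) (by omega) hP
    have h' := one hb h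
    have h'' := Nat.le_mul_of_pos_right (a + b) hP
    calc _ ≤ (2 * a) * ((2 * b) * (((a + b) * P) * 620) + 30 * (b * ((a + b) * P))) := by
          refine Nat.mul_le_mul (by omega) (Nat.add_le_add (Nat.mul_le_mul (by omega) ?_) ?_) <;>
            omega
      _ = _ := by ring
  have hS : a * b * P ≤ b * a ^ 2 * P := by
    calc a * b * P = 1 * (a * b * P) := (one_mul _).symm
      _ ≤ a * (a * b * P) := Nat.mul_le_mul_right _ ha
      _ = _ := by ring
  have hab : P ≤ a * b * P := Nat.le_mul_of_pos_left P (one ha hb)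
  have n1 := near a b ha hb
  have n2 := near b a hb ha
  have r1 := run a b ha hb
  have r2 := run b a hb ha
  rw [mul_comm b a] at n2
  have hS' : b * a ^ 2 * P ≤ (b * a ^ 2 + a * b ^ 2) * P := Nat.mul_le_mul_right _ (by omega)
  have e := add_mul (b * a ^ 2) (a * b ^ 2) P
  linarith [Nat.zero_le (a * b * H), Nat.zero_le (a * b ^ 2 * P), Nat.zero_le (b * a ^ 2 * P)]

lemma initial_sized (I : Instance n) : Sized I I.initial := by
  constructor <;> simp [Instance.initial]

lemma runs_frechetProg (h : I.Polygonal) (hP : 1 ≤ P) :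
    Runs I H P frechetProg I.initial
      (20000 * ((I.mg * I.mf ^ 2 + I.mf * I.mg ^ 2) * P + I.mf * I.mg * H))
      fun s => s.reals 0 0 = I.dist := by
  have z : ∀ o i, I.initial.reals (arrR o) i = 0 := by
    intro o i
    cases o <;> simp [Instance.initial, arrR]
  have hs₀ := initial_sized I
  refine Runs.seq_mid (runs_nearestProg h hs₀ false) ?_
    (total_time_le h.mf_pos h.mg_pos hP)
  rintro s₁ ⟨hf₁, hx₁⟩
  have hs₁ := hs₀.frame hf₁ (by simp)
  refine Runs.seq_mid (runs_nearestProg h hs₁ true) ?_ le_rfl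
  rintro s₂ ⟨hf₂, hx₂⟩
  have hs₂ := hs₁.frame hf₂ (by simp)
  refine Runs.seq_mid (runs_runCostProg hs₂ false fun i => ?_) ?_ le_rfl
  · rw [hf₂.reals _ (by simp [arrR, arrX]), hf₁.reals _ (by simp [arrR, arrX]), z]
  rintro s₃ ⟨hf₃, hr₃⟩
  have hs₃ := hs₂.frame hf₃ (by simp)
  refine Runs.seq_mid (runs_runCostProg hs₃ true fun i => ?_) ?_ le_rfl
  · rw [hf₃.reals _ (by simp [arrR]), hf₂.reals _ (by simp [arrR, arrX]),
      hf₁.reals _ (by simp [arrR, arrX]), z]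
  rintro s₄ ⟨hf₄, hr₄⟩
  have hs₄ := hs₃.frame hf₄ (by simp)
  have hR : ∀ o, RunTable I o (s₄.reals (arrR o)) := by
    intro o
    cases o
    · rw [hf₄.reals _ (by simp [arrR])]
      refine runTable_of_runCost h ?_ hr₃
      rw [hf₂.reals _ (by simp [arrX])]
      exact hx₁
    · refine runTable_of_runCost h ?_ hr₄
      rw [hf₃.reals _ (by simp [arrX, arrR])]
      exact hx₂
  refine Runs.seq_mid (runs_boundProg hs₄) ?_ le_rfl
  rintro s₅ ⟨hf₅, hb₅⟩
  have hs₅ := hs₄.frame hf₅ (by simp)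
  refine Runs.seq_mid (runs_reachProg hs₅ hb₅ fun o => ?_) ?_ le_rfl
  · rw [hf₅.reals _ (by cases o <;> simp [arrR])]
    exact hR o
  rintro s₆ ⟨hf₆, hd₆⟩
  have hs₆ := hs₅.frame hf₆ (by simp)
  refine (runs_outputProg hs₆).mono le_rfl fun s₇ hs₇ => ?_
  have hmf := h.mf_pos
  have hmg := h.mg_pos
  have hd := hd₆ (I.mf - 1) (I.mg - 1) (by omega) (by omega)
  rw [hs₇]
  exact (Instance.dist_eq_of_reachCost h
    (hR false 0 (I.mf - 1) 0 (Nat.sub_lt hmf one_pos) hmg)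
    (hR true 0 (I.mg - 1) (I.mf - 1) (Nat.sub_lt hmg one_pos) (Nat.sub_lt hmf one_pos))
    hd.1 hd.2).symm

end FrechetAlgo

theorem mainTheorem2 :
    ∃ (prog : FrechetAlgo.Prog) (C : ℝ), ∀ (n : ℕ) (χ : Seminorm ℝ (Fin n → ℝ)),
      (∀ x, χ x = 0 → x = 0) →
      ∀ (mf mg : ℕ), 1 ≤ mf → 1 ≤ mg →
      ∀ (f g : ℝ → Fin n → ℝ), FrechetAlgo.IsPolygonal mf f → FrechetAlgo.IsPolygonal mg g →
      ∀ (H P : ℕ), 1 ≤ H → 1 ≤ P →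
      ∃ (s : FrechetAlgo.State) (time : ℕ),
        FrechetAlgo.Exec ⟨χ, mf, mg, f, g⟩ H P prog
          (FrechetAlgo.Instance.initial ⟨χ, mf, mg, f, g⟩) s time ∧
        s.reals 0 0 = FrechetAlgo.frechetDist χ f 0 mf g 0 mg ∧
        (time : ℝ) ≤ C * (((mg : ℝ) * (mf : ℝ) ^ 2 + (mf : ℝ) * (mg : ℝ) ^ 2)
            * ((P : ℝ) + Real.log ((mg : ℝ) * (mf : ℝ)))
          + (mf : ℝ) * (mg : ℝ) * (H : ℝ)) := by
  refine ⟨FrechetAlgo.frechetProg, 20000, ?_⟩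
  intro n χ _ mf mg hmf hmg f g hf hg H P _ hP
  obtain ⟨s, t, hexec, ht, hs⟩ := FrechetAlgo.runs_frechetProg (H := H)
    (I := ⟨χ, mf, mg, f, g⟩) ⟨hf, hg, hmf, hmg⟩ hP
  refine ⟨s, t, hexec, hs, ?_⟩
  -- The time is bounded without the logarithm, so its nonnegativity suffices.
  have hlog : 0 ≤ Real.log ((mg : ℝ) * (mf : ℝ)) :=
    Real.log_nonneg (by exact_mod_cast Nat.mul_pos hmg hmf)
  have ht' : (t : ℝ) ≤ 20000 * (((mg : ℝ) * (mf : ℝ) ^ 2 + (mf : ℝ) * (mg : ℝ) ^ 2) * P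
      + (mf : ℝ) * (mg : ℝ) * (H : ℝ)) := by exact_mod_cast ht
  refine ht'.trans ?_
  gcongr
  linarith
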